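/- Let $K$ be a field and let $\mathcal A$ be an essential affine complex hyperplane arrangement: a finite set of affine hyperplanes in $\mathbb C^\ell$, some of which intersect in exactly one point. Let $V$ be the $K$-vector space with basis $\{e_H\}_{H\in\mathcal A}$, let $E=\bigwedge V$, and let $A=E/I$ be the Orlik–Solomon algebra of $\mathcal A$, where $I$ is the two-sided ideal generated by the elements $$\partial(e_{H_1}\wedge\cdots\wedge e_{H_t})=\sum_{j=1}^{t}(-1)^j\,e_{H_1}\wedge\cdots\wedge\widehat{e_{H_j}}\wedge\cdots\wedge e_{H_t}$$ for which $\{H_1,\dots,H_t\}\subseteq\mathcal A$ is a minimal dependent set of $t$ distinct hyperplanes (dependent: the intersection is nonempty and of codimension less than $t$), and by the monomials $e_{H_1}\wedge\cdots\wedge e_{H_t}$ for which the distinct hyperplanes $H_1,\dots,H_t\in\mathcal A$ have empty intersection. The singular variety of an $E$-module $M$ is $$\operatorname{sing}(M)=\{x\in V : \{m\in M: xm=0\}\neq xM\}.$$ The product of arrangements in $\mathbb C^{k}$ and $\mathbb C^{m}$ consists of the hyperplanes $H\times\mathbb C^{m}$, with $H$ in the first one, and $\mathbb C^{k}\times H$,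 with $H$ in the second one; products are taken up to affine isomorphism. An arrangement in $\mathbb C^k$, $k>0$, is irreducible if it is not a product of two arrangements in spaces of positive dimension, and it is central if the intersection of all its hyperplanes is nonempty. **Corollary 2.3.** The arrangement $\mathcal A$ is a product of finitely many irreducible arrangements (the empty product being the empty arrangement in $\mathbb C^0$). For every such irreducible decomposition $\mathcal A=\mathcal A_1\times\cdots\times\mathcal A_r$, with each $\mathcal A_j$ also regarded as a subset of $\mathcal A$, the singular variety of $A$ is the linear subspace $$\Big\{x=\sum_{H\in\mathcal A}x_He_H\in V \;:\; \sum_{H\in\mathcal A_j}x_H=0\text{ for every }j\text{ such that }\mathcal A_j\text{ is central}\Big\},$$ and the singular variety of the $K$-dual $E$-module $\operatorname{Hom}_K(A,K)$ (which is identified with the homology $H_*(X)$ of the complement $X$ of $\mathcal A$ through the Orlik–Solomon isomorphism $A\cong H^*(X;K)$) is the same subspace. In particular its codimension in $V$ is the number of central factors $\mathcal A_j$. -/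

import Mathlib

noncomputable section

namespace OSArr

/-- The affine space `ℂ^ℓ`. -/
abbrev Space (ℓ : ℕ) : Type := Fin ℓ → ℂ

/-- An affine hyperplane of `ℂ^ℓ`: the zero set of an equation `f v = c` with `f ≠ 0` linear. -/
def IsAffineHyperplane {ℓ : ℕ} (H : AffineSubspace ℂ (Space ℓ)) : Prop :=
  ∃ (f : Module.Dual ℂ (Space ℓ)) (c : ℂ), f ≠ 0 ∧ ∀ v, v ∈ H ↔ f v = c

/-- An affine complex hyperplane arrangement: a finite set of affine hyperplanes in `ℂ^ℓ`. -/
structure Arrangement (ℓ : ℕ) where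
  hyperplanes : Finset (AffineSubspace ℂ (Space ℓ))
  isAffineHyperplane : ∀ H ∈ hyperplanes, IsAffineHyperplane H

/-- The intersection of a finite set of affine subspaces (the whole space for the empty set). -/
def inter {ℓ : ℕ} (S : Finset (AffineSubspace ℂ (Space ℓ))) : AffineSubspace ℂ (Space ℓ) :=
  S.inf id

/-- The intersection poset (the nonempty intersections of members) has rank `ℓ`: some
intersection of members is a single point. -/
def Arrangement.IsEssential {ℓ : ℕ} (A : Arrangement ℓ) : Prop :=
  ∃ S ⊆ A.hyperplanes, ∃ p, (inter S : Set (Space ℓ)) = {p}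

/-- The intersection of all the hyperplanes is nonempty. -/
def Arrangement.IsCentral {ℓ : ℕ} (A : Arrangement ℓ) : Prop :=
  (inter A.hyperplanes : Set (Space ℓ)).Nonempty

/-! ### Products and irreducible arrangements -/

/-- `A` is, in suitable affine coordinates on `ℂ^ℓ`, the product `B × C`: its members are the
`H × ℂ^m` for `H ∈ B` and the `ℂ^k × H` for `H ∈ C`. -/
def Arrangement.IsProduct {ℓ k m : ℕ} (A : Arrangement ℓ) (B : Arrangement k)
    (C : Arrangement m) : Prop :=
  ∃ φ : Space ℓ ≃ᵃ[ℂ] (Space k × Space m), ∀ H : AffineSubspace ℂ (Space ℓ),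
    H ∈ A.hyperplanes ↔
      (∃ H' ∈ B.hyperplanes, H = H'.comap (AffineMap.fst.comp φ.toAffineMap)) ∨
      (∃ H' ∈ C.hyperplanes, H = H'.comap (AffineMap.snd.comp φ.toAffineMap))

/-- A positive-dimensional arrangement is irreducible if it is not a product of two
positive-dimensional arrangements. -/
def Arrangement.IsIrreducible {ℓ : ℕ} (A : Arrangement ℓ) : Prop :=
  0 < ℓ ∧ ∀ (k m : ℕ) (B : Arrangement k) (C : Arrangement m),
    A.IsProduct B C → k = 0 ∨ m = 0

/-- An expression of `A` as a product of finitely many irreducible arrangements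
(in suitable affine coordinates; the empty product is the empty arrangement in `ℂ^0`). -/
structure IrreducibleDecomposition {ℓ : ℕ} (A : Arrangement ℓ) where
  /-- the number of factors -/
  r : ℕ
  dim : Fin r → ℕ
  factor : (j : Fin r) → Arrangement (dim j)
  irreducible : ∀ j, (factor j).IsIrreducible
  coord : Space ℓ ≃ᵃ[ℂ] ((j : Fin r) → Space (dim j))
  mem_iff : ∀ H : AffineSubspace ℂ (Space ℓ), H ∈ A.hyperplanes ↔
    ∃ j, ∃ H' ∈ (factor j).hyperplanes,
      H = H'.comap ((AffineMap.proj (k := ℂ) j).comp coord.toAffineMap)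

open Classical in
/-- The `j`-th factor, regarded as a set of hyperplanes of `A`. -/
def IrreducibleDecomposition.block {ℓ : ℕ} {A : Arrangement ℓ}
    (D : IrreducibleDecomposition A) (j : Fin D.r) : Finset A.hyperplanes :=
  Finset.univ.filter fun H => ∃ H' ∈ (D.factor j).hyperplanes,
    H.1 = H'.comap ((AffineMap.proj (k := ℂ) j).comp D.coord.toAffineMap)

/-! ### The Orlik-Solomon algebra -/

/-- A set of hyperplanes is dependent if it has nonempty intersection, of codimension
smaller than the number of hyperplanes. -/
def IsDependent {ℓ : ℕ} (S : Finset (AffineSubspace ℂ (Space ℓ))) : Prop :=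
  (inter S : Set (Space ℓ)).Nonempty ∧
    ℓ < S.card + Module.finrank ℂ (inter S).direction

/-- The space `V` with canonical basis indexed by the hyperplanes; the coordinates of `x` in
this basis are the values `x H`. -/
abbrev V (K : Type*) [Field K] {ℓ : ℕ} (A : Arrangement ℓ) : Type _ := A.hyperplanes → K

open Classical in
/-- The canonical basis vector `e_H` of `V`. -/
def e (K : Type*) [Field K] {ℓ : ℕ} (A : Arrangement ℓ) (H : A.hyperplanes) : V K A :=
  Pi.single H 1

/-- The exterior algebra `E` on `V`. -/
abbrev E (K : Type*) [Field K] {ℓ : ℕ} (A : Arrangement ℓ) : Type _ := ExteriorAlgebra K (V K A)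

/-- The monomial `e_{H_1} ∧ ⋯ ∧ e_{H_t}`. -/
def mono (K : Type*) [Field K] {ℓ : ℕ} (A : Arrangement ℓ) {t : ℕ}
    (s : Fin t → A.hyperplanes) : E K A :=
  ExteriorAlgebra.ιMulti K t fun i => e K A (s i)

/-- `∂(e_{H_1} ∧ ⋯ ∧ e_{H_t}) = ∑ j, (-1)^j e_{H_1} ∧ ⋯ ê_{H_j} ⋯ ∧ e_{H_t}`
(with `t + 1` in place of `t`, and `j` counted from `1` in the sign). -/
def boundary (K : Type*) [Field K] {ℓ : ℕ} (A : Arrangement ℓ) {t : ℕ}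
    (s : Fin (t + 1) → A.hyperplanes) : E K A :=
  ∑ j : Fin (t + 1), (-1 : E K A) ^ ((j : ℕ) + 1) * mono K A fun i => s (j.succAbove i)

/-- The set of hyperplanes listed by `s`. -/
def support {ℓ : ℕ} {A : Arrangement ℓ} {t : ℕ} (s : Fin t ↪ A.hyperplanes) :
    Finset (AffineSubspace ℂ (Space ℓ)) :=
  Finset.univ.map (s.trans (Function.Embedding.subtype _))

/-- The generators of the Orlik-Solomon ideal. -/
def osGenerators (K : Type*) [Field K] {ℓ : ℕ} (A : Arrangement ℓ) : Set (E K A) :=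
  {y | ∃ (t : ℕ) (s : Fin (t + 1) ↪ A.hyperplanes),
      Minimal IsDependent (support s) ∧ y = boundary K A s} ∪
  {y | ∃ (t : ℕ) (s : Fin t ↪ A.hyperplanes),
      (inter (support s) : Set (Space ℓ)) = ∅ ∧ y = mono K A s}

/-- The Orlik-Solomon ideal, a two-sided ideal of `E`. -/
def osIdeal (K : Type*) [Field K] {ℓ : ℕ} (A : Arrangement ℓ) : Ideal (E K A) :=
  (TwoSidedIdeal.span (osGenerators K A)).asIdeal

instance (K : Type*) [Field K] {ℓ : ℕ} (A : Arrangement ℓ) : (osIdeal K A).IsTwoSided := by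
  unfold osIdeal; infer_instance

/-- The Orlik-Solomon algebra `E / I`, a `K`-algebra and an `E`-module. -/
abbrev OSAlgebra (K : Type*) [Field K] {ℓ : ℕ} (A : Arrangement ℓ) : Type _ :=
  E K A ⧸ osIdeal K A

/-! ### Singular varieties and dual modules over an exterior algebra -/

/-- The singular variety of a module `M` over the exterior algebra of `U`: the `x ∈ U` such that
the set of elements of `M` annihilated by `x` is not `x M`. -/
def singularVariety (K : Type*) [Field K] (U : Type*) [AddCommGroup U] [Module K U]
    (M : Type*) [AddCommGroup M] [Module (ExteriorAlgebra K U) M] : Set U :=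
  {x | {m : M | ExteriorAlgebra.ι K x • m = 0} ≠
    Set.range fun m : M => ExteriorAlgebra.ι K x • m}

/-- The `K`-dual `Hom_K(M, K)` of a module over the exterior algebra of `U`. -/
def DualModule (K : Type*) [Field K] (U : Type*) [AddCommGroup U] [Module K U]
    (M : Type*) [AddCommGroup M] [Module K M] [Module (ExteriorAlgebra K U) M]
    [IsScalarTower K (ExteriorAlgebra K U) M] : Type _ := Module.Dual K M

section
variable (K : Type*) [Field K] (U : Type*) [AddCommGroup U] [Module K U]
    (M : Type*) [AddCommGroup M] [Module K M] [Module (ExteriorAlgebra K U) M]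
    [IsScalarTower K (ExteriorAlgebra K U) M]

instance : AddCommGroup (DualModule K U M) := inferInstanceAs (AddCommGroup (Module.Dual K M))

/-- `Hom_K(M, K)` is a right module; it is made a left module through the anti-automorphism of
the exterior algebra that is the identity on `U`: `(a • f) m = f (aᵗ • m)`, where
`(x_1 ∧ ⋯ ∧ x_p)ᵗ = x_p ∧ ⋯ ∧ x_1`. In particular `(x • f) m = f (x • m)` for `x ∈ U`. -/
instance : Module (ExteriorAlgebra K U) (DualModule K U M) where
  smul a f := (show Module.Dual K M from f) ∘ₗ
    Module.toModuleEnd K (S := ExteriorAlgebra K U) M (CliffordAlgebra.reverse a)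
  one_smul f := LinearMap.ext fun m => by
    change (show Module.Dual K M from f) (CliffordAlgebra.reverse (1 : ExteriorAlgebra K U) • m) = _
    rw [CliffordAlgebra.reverse.map_one, one_smul]
  mul_smul a b f := LinearMap.ext fun m => by
    change (show Module.Dual K M from f) (CliffordAlgebra.reverse (a * b) • m) =
      (show Module.Dual K M from f) (CliffordAlgebra.reverse b • CliffordAlgebra.reverse a • m)
    rw [CliffordAlgebra.reverse.map_mul, mul_smul]
  smul_zero a := rfl
  smul_add a f g := rfl
  add_smul a b f := LinearMap.ext fun m => by
    change (show Module.Dual K M from f) (CliffordAlgebra.reverse (a + b) • m) =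
      (show Module.Dual K M from f) (CliffordAlgebra.reverse a • m) +
      (show Module.Dual K M from f) (CliffordAlgebra.reverse b • m)
    rw [map_add, add_smul, map_add]
  zero_smul f := LinearMap.ext fun m => by
    change (show Module.Dual K M from f) (CliffordAlgebra.reverse (0 : ExteriorAlgebra K U) • m) = 0
    rw [map_zero, zero_smul, map_zero]

end

/-- The `E`-module `Hom_K(E / I, K)`, identified with the homology of the complement through the
Orlik-Solomon isomorphism of `E / I` with its cohomology. -/
abbrev HomologyModule (K : Type*) [Field K] {ℓ : ℕ} (A : Arrangement ℓ) : Type _ :=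
  DualModule K (V K A) (OSAlgebra K A)

end OSArr

end

/-! Write `I` for the Orlik–Solomon ideal. Since `x * x = 0`, a vector `x` lies outside the singular
variety exactly when multiplication by `x` is exact on `E / I`.

Nonzero block sum. For a central factor, contraction by the sum `θ` of its coordinates preserves `I`
(`IsBlockProj.contr_mem`): every circuit lies inside or outside the block, and an inconsistency
among equations never needs those of a central block. The identity `contr θ (x * a) + x * contr θ a
= θ x • a` makes this contraction a contracting homotopy up to the scalar `θ x`, so `x` acts exactly
if `θ x ≠ 0` (`exactOn_of_ne_zero`).

All central block sums zero. Suppose `x` acts exactly. Choose a hyperplane in each central block.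
Since the block form vanishes on `x` and is `1` on the chosen generator, exactness survives passing
to the quotient by that generator (`ExactOn.span_insert`). The final quotient behaves like the
Orlik–Solomon algebra of a vector configuration: the coefficient vectors of the equations, together
with `v₀`, the vector of the hyperplane at infinity, modulo the subspace `gluing` that identifies
each chosen hyperplane with `v₀`. It has a basis of monomials without broken circuits, and exactness
of an odd operator forces as many basis monomials of even degree as of odd degree
(`nbcSum_eq_zero`).

That alternating count is, up to sign, Crapo's beta invariant. It satisfies deletion–contraction and
is nonzero for a connected configuration, because a connected matroid stays connected after deleting
or contracting any given element (`Conn.delete_or_contract`, `nbcSum_sign`). The glued configuration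
is connected: irreducibility prevents a block from splitting even relative to `v₀`, noncentral
blocks contain `v₀` in their span, and central ones are attached to it by the gluing
(`not_inf_le_gluing`). This is a contradiction.

The dual module has the same singular variety because a linear map satisfies kernel = range exactly
when its transpose does. Irreducible decompositions exist by induction on the dimension. -/

noncomputable section

namespace OSArr

/-! ### Monomials, contractions and coefficients in the exterior algebra -/

section Monomials

variable {K : Type*} [Field K] {ι : Type*}

open Classical in
/-- The standard basis vector of `ι → K`, as an element of degree one of the exterior algebra. -/
def gen (K : Type*) [Field K] {ι : Type*} (i : ι) : ExteriorAlgebra K (ι → K) :=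
  ExteriorAlgebra.ι K (Pi.single i 1)

/-- The monomial listed by `L`. -/
def monom (K : Type*) [Field K] {ι : Type*} (L : List ι) : ExteriorAlgebra K (ι → K) :=
  (L.map (gen K)).prod

/-- The contraction by the linear form with coefficients `θ`. -/
def contr (θ : Module.Dual K (ι → K)) :
    ExteriorAlgebra K (ι → K) →ₗ[K] ExteriorAlgebra K (ι → K) :=
  CliffordAlgebra.contractLeft (Q := (0 : QuadraticForm K (ι → K))) θ

@[simp] lemma monom_nil : monom K ([] : List ι) = 1 := rfl

@[simp] lemma monom_cons (i : ι) (L : List ι) : monom K (i :: L) = gen K i * monom K L := by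
  simp [monom]

lemma monom_append (L M : List ι) : monom K (L ++ M) = monom K L * monom K M := by
  simp [monom]

lemma contr_ι_mul (θ : Module.Dual K (ι → K)) (v : ι → K) (y : ExteriorAlgebra K (ι → K)) :
    contr θ (ExteriorAlgebra.ι K v * y) = θ v • y - ExteriorAlgebra.ι K v * contr θ y :=
  CliffordAlgebra.contractLeft_ι_mul _ v y

lemma contr_one (θ : Module.Dual K (ι → K)) : contr θ 1 = 0 :=
  CliffordAlgebra.contractLeft_one _ _

lemma contr_contr (θ : Module.Dual K (ι → K)) (y : ExteriorAlgebra K (ι → K)) :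
    contr θ (contr θ y) = 0 :=
  CliffordAlgebra.contractLeft_contractLeft _ y

lemma contr_algebraMap (θ : Module.Dual K (ι → K)) (r : K) :
    contr θ (algebraMap K _ r) = 0 :=
  CliffordAlgebra.contractLeft_algebraMap _ _ r

open Classical in
lemma contr_gen_mul (θ : Module.Dual K (ι → K)) (i : ι) (y : ExteriorAlgebra K (ι → K)) :
    contr θ (gen K i * y) = θ (Pi.single i 1) • y - gen K i * contr θ y :=
  contr_ι_mul _ _ _

lemma gen_mul_self (i : ι) : gen K i * gen K i = 0 := ExteriorAlgebra.ι_sq_zero _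

lemma ι_mul_comm (v w : ι → K) : ExteriorAlgebra.ι K v * ExteriorAlgebra.ι K w =
    - (ExteriorAlgebra.ι K w * ExteriorAlgebra.ι K v) :=
  eq_neg_of_add_eq_zero_left (ExteriorAlgebra.ι_add_mul_swap v w)

lemma gen_mul_comm (i j : ι) : gen K i * gen K j = - (gen K j * gen K i) := ι_mul_comm _ _

lemma monom_perm {L M : List ι} (h : L.Perm M) :
    monom K L = monom K M ∨ monom K L = - monom K M := by
  induction h with
  | nil => simp
  | cons i _ ih => rcases ih with h | h <;> simp [h]
  | swap i j L =>
    right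
    rw [monom_cons, monom_cons, monom_cons, monom_cons, ← mul_assoc, gen_mul_comm, neg_mul,
      mul_assoc]
  | trans _ _ h1 h2 => rcases h1 with h1 | h1 <;> rcases h2 with h2 | h2 <;> simp [h1, h2]

lemma monom_eq_zero {L : List ι} (h : ¬ L.Nodup) : monom K L = 0 := by
  rw [List.nodup_iff_sublist] at h
  push Not at h
  obtain ⟨i, hi⟩ := h
  obtain ⟨M, hM⟩ := hi.exists_perm_append
  have : monom K ([i, i] ++ M) = 0 := by
    simp [← mul_assoc, gen_mul_self]
  rcases monom_perm (K := K) hM with h | h <;> simp [h, ← mul_assoc, gen_mul_self]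

/-- Contraction is an antiderivation. -/
lemma contr_monom_mul (θ : Module.Dual K (ι → K)) (L : List ι) (y : ExteriorAlgebra K (ι → K)) :
    contr θ (monom K L * y) =
      contr θ (monom K L) * y + (-1 : K) ^ L.length • (monom K L * contr θ y) := by
  induction L with
  | nil => simp [contr_one]
  | cons i L ih =>
    rw [monom_cons, mul_assoc, contr_gen_mul, contr_gen_mul, ih, sub_mul, mul_add, smul_mul_assoc,
      mul_smul_comm, List.length_cons, pow_succ, mul_smul, mul_assoc, mul_assoc]
    simp only [neg_smul, one_smul, smul_neg]
    abel

-- Only factors on which `θ` is nonzero get removed. Keeping the removed index `c` with its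
-- permutation lets later arguments ask which factor disappeared.
open Classical in
lemma contr_monom_mem (θ : Module.Dual K (ι → K)) (L : List ι) :
    contr θ (monom K L) ∈ Submodule.span K
      {y | ∃ c M, L.Perm (c :: M) ∧ θ (Pi.single c 1) ≠ 0 ∧ y = monom K M} := by
  induction L with
  | nil => simp [contr_one]
  | cons i L ih =>
    rw [monom_cons, contr_gen_mul]
    refine Submodule.sub_mem _ ?_ ?_
    · by_cases h : θ (Pi.single i 1) = 0
      · simp [h]
      · exact Submodule.smul_mem _ _ (Submodule.subset_span ⟨i, L, List.Perm.refl _, h, rfl⟩)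
    · refine Submodule.span_induction (p := fun y _ => gen K i * y ∈ _) ?_ ?_ ?_ ?_ ih
      · rintro _ ⟨c, M, h1, h2, rfl⟩
        refine Submodule.subset_span ⟨c, i :: M, ?_, h2, by simp⟩
        exact (h1.cons i).trans (List.Perm.swap _ _ _)
      · simp
      · intro x y _ _ hx hy
        rw [mul_add]; exact Submodule.add_mem _ hx hy
      · intro a x _ hx
        rw [mul_smul_comm]; exact Submodule.smul_mem _ _ hx

/-- The coefficient of the monomial listed by `L` (zero on monomials with other factors). -/
def coef (K : Type*) [Field K] {ι : Type*} : List ι → ExteriorAlgebra K (ι → K) →ₗ[K] K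
  | [] => (ExteriorAlgebra.algebraMapInv (R := K) (M := ι → K)).toLinearMap
  | i :: L => coef K L ∘ₗ contr (LinearMap.proj i)

/-- Each contraction in `coef` by a coordinate form can only remove the factor with that index, so
the scalar left at the end is nonzero only if the indices match. -/
lemma coef_monom_perm (L : List ι) : ∀ M : List ι, coef K L (monom K M) ≠ 0 → M.Perm L := by
  classical
  induction L with
  | nil =>
    intro M h
    cases M with
    | nil => exact List.Perm.refl _
    | cons i M => simp [coef, gen, ExteriorAlgebra.algebraMapInv] at h
  | cons i L ih =>
    intro M h
    by_contra hM
    apply h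
    have := contr_monom_mem (K := K) (LinearMap.proj i) M
    change coef K L (contr (LinearMap.proj i) (monom K M)) = 0
    refine Submodule.span_induction (p := fun y _ => coef K L y = 0) ?_ ?_ ?_ ?_ this
    · rintro _ ⟨c, N, h1, h2, rfl⟩
      by_contra h3
      have hc : i = c := by
        by_contra hne
        exact h2 (by simp [hne])
      subst hc
      exact hM (h1.trans ((ih N h3).cons i))
    · simp
    · intro x y _ _ hx hy
      rw [map_add, hx, hy, add_zero]
    · intro a x _ hx
      rw [map_smul, hx, smul_zero]

lemma coef_monom_self {L : List ι} (h : L.Nodup) : coef K L (monom K L) = 1 := by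
  classical
  induction L with
  | nil => simp [coef]
  | cons i L ih =>
    rw [List.nodup_cons] at h
    have hz : contr (LinearMap.proj i) (monom K L) = 0 := by
      have := contr_monom_mem (K := K) (LinearMap.proj i) L
      refine (Submodule.mem_bot K).1 ((Submodule.span_le.2 ?_) this)
      rintro _ ⟨c, N, h1, h2, rfl⟩
      exfalso
      have hc : i = c := by
        by_contra hne
        exact h2 (by simp [hne])
      subst hc
      exact h.1 (h1.mem_iff.2 (by simp))
    change coef K L (contr (LinearMap.proj i) (monom K (i :: L))) = 1
    rw [monom_cons, contr_gen_mul, hz]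
    simp [ih h.2]

lemma ι_eq_sum [Fintype ι] (x : ι → K) : ExteriorAlgebra.ι K x = ∑ i, x i • gen K i := by
  classical
  conv_lhs => rw [pi_eq_sum_univ' x]
  simp only [map_sum, map_smul]
  refine Finset.sum_congr rfl fun i _ => ?_
  rw [gen]

lemma monom_span_top [Finite ι] :
    Submodule.span K (Set.range (monom K : List ι → _)) = ⊤ := by
  classical
  have := Fintype.ofFinite ι
  rw [eq_top_iff]
  rintro y -
  induction y using CliffordAlgebra.left_induction with
  | algebraMap r =>
    rw [Algebra.algebraMap_eq_smul_one]
    exact Submodule.smul_mem _ _ (Submodule.subset_span ⟨[], rfl⟩)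
  | add x y hx hy => exact Submodule.add_mem _ hx hy
  | ι_mul x v hx =>
    refine Submodule.span_induction
      (p := fun y _ => ExteriorAlgebra.ι K v * y ∈ Submodule.span K (Set.range (monom K)))
      ?_ ?_ ?_ ?_ hx
    · rintro _ ⟨L, rfl⟩
      rw [ι_eq_sum, Finset.sum_mul]
      refine Submodule.sum_mem _ fun i _ => ?_
      rw [smul_mul_assoc, ← monom_cons]
      exact Submodule.smul_mem _ _ (Submodule.subset_span ⟨_, rfl⟩)
    · simp
    · intro x y _ _ hx hy
      rw [mul_add]; exact Submodule.add_mem _ hx hy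
    · intro a x _ hx
      rw [mul_smul_comm]; exact Submodule.smul_mem _ _ hx

end Monomials

end OSArr

end

noncomputable section

namespace OSArr

/-! ### Sets without broken circuits in a vector configuration -/

section BrokenCircuits

open Module Submodule

variable {F W ι : Type*} [Field F] [AddCommGroup W] [Module F W] (v : ι → W) (v₀ : W)

/-- The span of the vectors indexed by `X`, modulo `U`. -/
def sp (U : Submodule F W) (X : Set ι) : Submodule F W := U ⊔ span F (v '' X)

lemma sp_mono {U U' : Submodule F W} {X X' : Set ι} (hU : U ≤ U') (hX : X ⊆ X') :
    sp v U X ≤ sp v U' X' :=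
  sup_le_sup hU (span_mono (Set.image_mono hX))

lemma le_sp (U : Submodule F W) (X : Set ι) : U ≤ sp v U X := le_sup_left

lemma mem_sp {U : Submodule F W} {X : Set ι} {i : ι} (hi : i ∈ X) : v i ∈ sp v U X :=
  mem_sup_right (subset_span ⟨i, hi, rfl⟩)

@[simp] lemma sp_empty (U : Submodule F W) : sp v U ∅ = U := by simp [sp]

lemma sp_insert (U : Submodule F W) (e : ι) (X : Set ι) :
    sp v U (insert e X) = sp v (U ⊔ span F {v e}) X := by
  simp [sp, Set.image_insert_eq, span_insert, sup_assoc]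

lemma sp_sup (U U' : Submodule F W) (X : Set ι) : sp v (U ⊔ U') X = sp v U X ⊔ U' := by
  simp only [sp, sup_assoc, sup_comm U']

lemma sp_le {U V : Submodule F W} {X : Set ι} (hU : U ≤ V) (hX : ∀ i ∈ X, v i ∈ V) :
    sp v U X ≤ V :=
  sup_le hU (span_le.2 (by rintro _ ⟨i, hi, rfl⟩; exact hX i hi))

/-- A form of the modular law: enlarging `A` by a vector outside `B` adds nothing inside `B`. It is
used to show that contracting a coloop does not affect spans of the other vectors. -/
lemma mem_sup_span_singleton_iff {A B : Submodule F W} {w x : W} (hA : A ≤ B) (hw : w ∉ B)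
    (hx : x ∈ B) : x ∈ A ⊔ span F {w} ↔ x ∈ A := by
  refine ⟨fun h => ?_, fun h => mem_sup_left h⟩
  obtain ⟨a, ha, b, hb, rfl⟩ := mem_sup.1 h
  obtain ⟨c, rfl⟩ := mem_span_singleton.1 hb
  have hc : c • w ∈ B := by simpa using B.sub_mem hx (hA ha)
  by_cases h0 : c = 0
  · simpa [h0] using ha
  · exact absurd ((B.smul_mem_iff h0).1 hc) hw

lemma sup_singleton_of_mem {A : Submodule F W} {w : W} (hw : w ∈ A) : A ⊔ span F {w} = A :=
  sup_eq_left.2 ((span_singleton_le_iff_mem _ _).2 hw)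

section
variable [FiniteDimensional F W]

lemma finrank_sup_singleton_le (A : Submodule F W) (w : W) :
    finrank F ↑(A ⊔ span F {w}) ≤ finrank F A + 1 := by
  have := Submodule.finrank_add_le_finrank_add_finrank A (span F {w})
  have h1 : finrank F (span F {w}) ≤ 1 := by
    have := finrank_span_finset_le_card (R := F) ({w} : Finset W)
    rwa [Finset.coe_singleton, Finset.card_singleton] at this
  omega

lemma finrank_sup_singleton {A : Submodule F W} {w : W} (hw : w ∉ A) :
    finrank F ↑(A ⊔ span F {w}) = finrank F A + 1 := by
  refine le_antisymm (finrank_sup_singleton_le A w) ?_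
  refine Submodule.finrank_lt_finrank_of_lt (lt_of_le_of_ne le_sup_left fun h => hw ?_)
  rw [h]
  exact mem_sup_right (mem_span_singleton_self _)

lemma finrank_submodular {A B C D : Submodule F W} (hC : C ≤ A ⊔ B) (hDA : D ≤ A)
    (hDB : D ≤ B) : finrank F C + finrank F D ≤ finrank F A + finrank F B := by
  rw [← Submodule.finrank_sup_add_finrank_inf_eq A B]
  exact add_le_add (Submodule.finrank_mono hC) (Submodule.finrank_mono (le_inf hDA hDB))

/-- Submodularity of the rank. Allowing two base spaces `U ≤ U'` makes it possible to carry `v₀` on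
one side only. -/
lemma sp_submodular {v : ι → W} {U U' : Submodule F W} (hU : U ≤ U') (X Y C D : Set ι) (hC : C ⊆ X ∪ Y)
    (hD : D ⊆ X ∩ Y) :
    finrank F (sp v U' C) + finrank F (sp v U D) ≤
      finrank F (sp v U' X) + finrank F (sp v U Y) := by
  refine finrank_submodular (sp_le v (le_sup_of_le_left (le_sp _ _ _)) ?_)
    (sp_mono v hU fun i hi => (hD hi).1) (sp_mono v le_rfl fun i hi => (hD hi).2)
  intro i hi
  rcases hC hi with h | h
  · exact mem_sup_left (mem_sp v h)
  · exact mem_sup_right (mem_sp v h)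

end

variable [LinearOrder ι]

/-- `S` contains no broken circuit of the configuration `v₀, (v i)_{i ∈ J}` modulo `U`, where
`v₀` is regarded as the smallest element. -/
def IsNBC (U : Submodule F W) (J S : Finset ι) : Prop :=
  S ⊆ J ∧ v₀ ∉ sp v U S ∧ ∀ i ∈ J, v i ∉ sp v U {s | s ∈ S ∧ i < s}

open Classical in
/-- The alternating sum of the numbers of sets without broken circuits. -/
def nbcSum (U : Submodule F W) (J : Finset ι) : ℤ :=
  ∑ S ∈ J.powerset, if IsNBC v v₀ U J S then (-1) ^ S.card else 0

/-- Every nonempty part of the configuration `v₀, (v i)_{i ∈ J}`, taken modulo `U`, that avoids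
`v₀` has a nontrivial linear relation to the complementary part. -/
def Conn (U : Submodule F W) (J : Finset ι) : Prop :=
  v₀ ∉ U ∧ ∀ Q ⊆ J, Q.Nonempty →
    finrank F (sp v (U ⊔ span F {v₀}) J) + finrank F U <
      finrank F (sp v U Q) + finrank F (sp v (U ⊔ span F {v₀}) ↑(J \ Q))

variable {v v₀} {U : Submodule F W} {J S : Finset ι} {e : ι}

/-- The largest element `e` belongs to no tail of `S`; its own tail is empty, so it contributes only
the condition `v e ∉ U`. -/
lemma isNBC_insert_iff (hS : S ⊆ J) (hJ : ∀ i ∈ J, i < e) (he : v e ∉ U) :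
    IsNBC v v₀ U (insert e J) S ↔ IsNBC v v₀ U J S := by
  have h0 : {s | s ∈ S ∧ e < s} = ∅ := by
    ext s
    simp only [Set.mem_ofPred_eq, Set.mem_empty_iff_false, iff_false, not_and, not_lt]
    exact fun h => (hJ s (hS h)).le
  simp only [IsNBC, Finset.forall_mem_insert, h0, sp_empty, he, not_false_eq_true, true_and,
    hS, hS.trans (Finset.subset_insert e J)]

/-- Being largest, `e` lies in the tail above every `i ∈ J`, so its vector can be moved into the
base space: this is contraction. -/
lemma isNBC_insert_insert_iff (hS : S ⊆ J) (hJ : ∀ i ∈ J, i < e) (he : v e ∉ U) :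
    IsNBC v v₀ U (insert e J) (insert e S) ↔ IsNBC v v₀ (U ⊔ span F {v e}) J S := by
  have h0 : {s | s ∈ insert e S ∧ e < s} = ∅ := by
    ext s
    simp only [Finset.mem_insert, Set.mem_ofPred_eq, Set.mem_empty_iff_false, iff_false, not_and,
      not_lt]
    rintro (rfl | h)
    exacts [le_rfl, (hJ s (hS h)).le]
  have h1 : ∀ i ∈ J, {s | s ∈ insert e S ∧ i < s} = insert e {s | s ∈ S ∧ i < s} := by
    intro i hi
    ext s
    simp only [Finset.mem_insert, Set.mem_ofPred_eq, Set.mem_insert_iff]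
    constructor
    · rintro ⟨rfl | h, h2⟩
      exacts [Or.inl rfl, Or.inr ⟨h, h2⟩]
    · rintro (rfl | h)
      exacts [⟨Or.inl rfl, hJ i hi⟩, ⟨Or.inr h.1, h.2⟩]
  simp only [IsNBC, Finset.forall_mem_insert, h0, sp_empty, he, not_false_eq_true, true_and,
    hS, Finset.insert_subset_insert e hS, Finset.coe_insert, sp_insert]
  refine and_congr_right fun _ => forall₂_congr fun i hi => ?_
  rw [h1 i hi, sp_insert]

lemma nbcSum_of_mem (he : e ∈ J) (hU : v e ∈ U) : nbcSum v v₀ U J = 0 := by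
  refine Finset.sum_eq_zero fun S _ => if_neg fun h => h.2.2 e he (le_sp v U _ hU)

/-- Deletion–contraction at the largest element: sets avoiding `e` count for the deletion, sets
containing it for the contraction, with one more sign. -/
lemma nbcSum_insert (hJ : ∀ i ∈ J, i < e) (he : v e ∉ U) :
    nbcSum v v₀ U (insert e J) = nbcSum v v₀ U J - nbcSum v v₀ (U ⊔ span F {v e}) J := by
  classical
  have heJ : e ∉ J := fun h => lt_irrefl _ (hJ e h)
  rw [nbcSum, Finset.sum_powerset_insert heJ, nbcSum, nbcSum, sub_eq_add_neg,
    ← Finset.sum_neg_distrib]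
  congr 1
  · refine Finset.sum_congr rfl fun S hS => ?_
    rw [Finset.mem_powerset] at hS
    simp only [isNBC_insert_iff hS hJ he]
  · refine Finset.sum_congr rfl fun S hS => ?_
    rw [Finset.mem_powerset] at hS
    simp only [isNBC_insert_insert_iff hS hJ he]
    rw [Finset.card_insert_of_notMem (fun h => heJ (hS h)), pow_succ]
    split_ifs <;> simp

/-- For a coloop, deletion and contraction have the same sets without broken circuits, because all
memberships to be tested concern vectors in a span not containing `v e`. -/
lemma nbcSum_sup_coloop (he : v e ∉ sp v (U ⊔ span F {v₀}) J) :
    nbcSum v v₀ (U ⊔ span F {v e}) J = nbcSum v v₀ U J := by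
  classical
  refine Finset.sum_congr rfl fun S hS => ?_
  rw [Finset.mem_powerset] at hS
  have key : ∀ X : Set ι, X ⊆ J → ∀ x ∈ sp v (U ⊔ span F {v₀}) J,
      (x ∈ sp v (U ⊔ span F {v e}) X ↔ x ∈ sp v U X) := by
    intro X hX x hx
    rw [sp_sup]
    exact mem_sup_span_singleton_iff (sp_mono v le_sup_left hX) he hx
  have : IsNBC v v₀ (U ⊔ span F {v e}) J S ↔ IsNBC v v₀ U J S := by
    unfold IsNBC
    rw [key S (by exact_mod_cast hS) v₀
      (le_sp v _ _ (mem_sup_right (mem_span_singleton_self _)))]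
    refine and_congr_right fun _ => and_congr_right fun _ => forall₂_congr fun i hi => ?_
    rw [key _ (fun s hs => hS hs.1) (v i) (mem_sp v hi)]
  simp only [this]

/-! ### Connectedness and nonvanishing of the alternating sum -/

variable [FiniteDimensional F W]

/-- A nonzero element of a connected configuration can be deleted or contracted so that the
configuration remains connected. -/
lemma Conn.delete_or_contract (heJ : e ∉ J) (h : Conn v v₀ U (insert e J)) :
    Conn v v₀ U J ∨ Conn v v₀ (U ⊔ span F {v e}) J := by
  by_contra hcon
  push Not at hcon
  obtain ⟨h1, h2⟩ := hcon
  obtain ⟨hv0, h⟩ := h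
  -- A separator `T` of the deletion, on the side away from `v₀`.
  have hT : ∃ T ⊆ J, T.Nonempty ∧ finrank F (sp v U T) +
      finrank F (sp v (U ⊔ span F {v₀}) ↑(J \ T)) ≤
      finrank F (sp v (U ⊔ span F {v₀}) J) + finrank F U := by
    by_contra hT
    push Not at hT
    exact h1 ⟨hv0, hT⟩
  obtain ⟨T, hTJ, hT0, hT⟩ := hT
  have hswap : ∀ X : Set ι, sp v (U ⊔ span F {v e} ⊔ span F {v₀}) X =
      sp v (U ⊔ span F {v₀}) (insert e X) := by
    intro X
    rw [sp_insert, sup_assoc, sup_assoc, sup_comm (span F {v e})]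
  -- A separator `Q` of the contraction, with `e` put back into the sets so that all ranks are taken
  -- over the original base spaces.
  have hQ : ∃ Q ⊆ J, Q.Nonempty ∧ finrank F (sp v U (insert e (Q : Set ι))) +
      finrank F (sp v (U ⊔ span F {v₀}) (insert e ↑(J \ Q))) ≤
      finrank F (sp v (U ⊔ span F {v₀}) (insert e (J : Set ι))) +
        finrank F ↑(U ⊔ span F {v e}) := by
    by_contra hQ
    push Not at hQ
    apply h2
    constructor
    · intro hv
      -- If `v₀ ∈ U ⊔ span F {v e}`, both sides of the strict inequality for `Q = J` coincide.
      have := hQ J le_rfl (hT0.mono hTJ)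
      rw [sdiff_self, Finset.bot_eq_empty, Finset.coe_empty, sp_insert, sp_insert, sp_insert,
        sp_empty, sup_assoc, sup_comm (span F {v₀}), ← sup_assoc,
        sup_singleton_of_mem hv] at this
      exact lt_irrefl _ this
    · intro Q hQJ hQ0
      rw [hswap, hswap, ← sp_insert]
      exact hQ Q hQJ hQ0
  obtain ⟨Q, hQJ, hQ0, hQ⟩ := hQ
  -- Connectedness at `{e}` makes `e` neither a loop nor a coloop: adjoining it to `U` raises the
  -- rank by one, adjoining it to `J` and `v₀` does not raise it.
  have he := h {e} (by simp) (by simp)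
  have hJe : insert e J \ {e} = J := by
    ext x; simp only [Finset.mem_sdiff, Finset.mem_insert, Finset.mem_singleton]
    constructor
    · rintro ⟨h | h, h'⟩
      exacts [absurd h h', h]
    · exact fun hx => ⟨Or.inr hx, fun h => heJ (h ▸ hx)⟩
  have hse : sp v U ({e} : Finset ι) = U ⊔ span F {v e} := by
    rw [Finset.coe_singleton, ← insert_empty_eq, sp_insert, sp_empty]
  rw [hJe, hse] at he
  have hle := finrank_sup_singleton_le U (v e)
  have hmon : finrank F (sp v (U ⊔ span F {v₀}) J) ≤
      finrank F (sp v (U ⊔ span F {v₀}) ↑(insert e J)) :=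
    Submodule.finrank_mono (sp_mono v le_rfl (by simp))
  have hU : U ≤ U ⊔ span F {v₀} := le_sup_left
  have main : ∀ X ⊆ J, X.Nonempty → ∀ Y : Finset ι, (∀ i ∈ J, i ∈ Y ↔ i ∉ X) → Y ⊆ J →
      finrank F (sp v (U ⊔ span F {v₀}) ↑(insert e J)) + finrank F U <
      finrank F (sp v U X) + finrank F (sp v (U ⊔ span F {v₀}) (insert e (Y : Set ι))) := by
    intro X hX hX0 Y hY hYJ
    have := h X (hX.trans (Finset.subset_insert _ _)) hX0
    have hcomp : insert e J \ X = insert e Y := by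
      ext i
      simp only [Finset.mem_sdiff, Finset.mem_insert]
      constructor
      · rintro ⟨h | h, h'⟩
        exacts [Or.inl h, Or.inr ((hY i h).2 h')]
      · rintro (h | h)
        · exact ⟨Or.inl h, fun h' => heJ (h ▸ hX h')⟩
        · exact ⟨Or.inr (hYJ h), (hY i (hYJ h)).1 h⟩
    rwa [hcomp, Finset.coe_insert e Y] at this
  -- Uncrossing: if `T ∩ Q` is nonempty, connectedness at `T ∩ Q` and at `insert e (T ∪ Q)` gives
  -- two strict inequalities, a total gain of 2. Submodularity and the bounds for `T` and `Q` allow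
  -- a gain of at most 1, coming from the rank of `e` modulo `U`.
  have hTQ : T ∩ Q = ∅ := by
    by_contra hne
    have a1 := main (T ∩ Q) (Finset.inter_subset_left.trans hTJ) (Finset.nonempty_iff_ne_empty.2 hne)
      ((J \ T) ∪ (J \ Q)) (by grind) (by grind)
    have a2 := h (insert e (T ∪ Q)) (Finset.insert_subset_insert _ (Finset.union_subset hTJ hQJ))
      (by simp)
    have a3 : insert e J \ insert e (T ∪ Q) = (J \ T) ∩ (J \ Q) := by grind
    rw [a3] at a2
    have b1 := sp_submodular (v := v) (le_refl (U ⊔ span F {v₀})) ↑(J \ T) (insert e ↑(J \ Q))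
      (insert e ↑((J \ T) ∪ (J \ Q))) ↑((J \ T) ∩ (J \ Q)) (by intro i; simp)
      (by intro i; simp; tauto)
    have b2 := sp_submodular (v := v) (le_refl U) ↑T (insert e ↑Q) ↑(insert e (T ∪ Q)) ↑(T ∩ Q)
      (by intro i; simp) (by intro i; simp; tauto)
    rw [Finset.coe_insert e J] at a1 a2 he hmon
    rw [Finset.coe_insert e (T ∪ Q)] at a2 b2
    omega
  -- The same uncrossing applied to `Q` and the complement of `T`, with `v₀` on only one side in
  -- each use of submodularity. Together with `hTQ`, either alternative makes `Q` or `T` empty.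
  have hSQ : (J \ T) ∩ Q = ∅ ∨ T ∩ (J \ Q) = ∅ := by
    by_contra hne
    push Not at hne
    have a1 := main ((J \ T) ∩ Q) (by grind) hne.1 (T ∪ (J \ Q)) (by grind) (by grind)
    have a2 := main (T ∩ (J \ Q)) (by grind) hne.2 ((J \ T) ∪ Q) (by grind) (by grind)
    have b1 := sp_submodular (v := v) hU ↑(J \ T) (insert e ↑Q)
      (insert e ↑((J \ T) ∪ Q)) ↑((J \ T) ∩ Q) (by intro i; simp)
      (by intro i; simp; tauto)
    have b2 := sp_submodular (v := v) hU (insert e ↑(J \ Q)) ↑T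
      (insert e ↑(T ∪ (J \ Q))) ↑(T ∩ (J \ Q)) (by intro i; simp; tauto)
      (by intro i; simp; tauto)
    rw [Finset.coe_insert e J] at a1 a2 he hmon
    omega
  rcases hSQ with h3 | h3
  · obtain ⟨q, hq⟩ := hQ0
    by_cases hqT : q ∈ T
    · exact Finset.notMem_empty q (hTQ ▸ Finset.mem_inter.2 ⟨hqT, hq⟩)
    · exact Finset.notMem_empty q
        (h3 ▸ Finset.mem_inter.2 ⟨Finset.mem_sdiff.2 ⟨hQJ hq, hqT⟩, hq⟩)
  · obtain ⟨q, hq⟩ := hT0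
    by_cases hqQ : q ∈ Q
    · exact Finset.notMem_empty q (hTQ ▸ Finset.mem_inter.2 ⟨hq, hqQ⟩)
    · exact Finset.notMem_empty q
        (h3 ▸ Finset.mem_inter.2 ⟨hq, Finset.mem_sdiff.2 ⟨hTJ hq, hqQ⟩⟩)

/-- Positivity of the beta invariant. The exponent has the parity of the rank modulo `U`, including
`v₀`, minus one. Induct by removing the largest element; the base space varies because contraction
enlarges it. Loops and coloops give zero and rule out connectedness; otherwise deletion and
contraction contribute with the same sign. -/
lemma nbcSum_sign (J : Finset ι) : ∀ U : Submodule F W,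
    0 ≤ (-1) ^ (finrank F (sp v (U ⊔ span F {v₀}) J) + finrank F U + 1) * nbcSum v v₀ U J ∧
    (Conn v v₀ U J →
      0 < (-1) ^ (finrank F (sp v (U ⊔ span F {v₀}) J) + finrank F U + 1) * nbcSum v v₀ U J) := by
  induction J using Finset.induction_on_max with
  | empty =>
    intro U
    classical
    have hN : nbcSum v v₀ U ∅ = if v₀ ∈ U then 0 else 1 := by
      simp only [nbcSum, Finset.powerset_empty, Finset.sum_singleton, IsNBC]
      simp
    rw [hN, Finset.coe_empty, sp_empty]
    by_cases h : v₀ ∈ U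
    · simp [h, Conn]
    · rw [finrank_sup_singleton h]
      have : (-1 : ℤ) ^ (finrank F U + 1 + finrank F U + 1) = 1 :=
        Even.neg_one_pow ⟨finrank F U + 1, by ring⟩
      simp [this, h]
  | insert e J hJ ih =>
    intro U
    have heJ : e ∉ J := fun h => lt_irrefl _ (hJ e h)
    have hJe : insert e J \ {e} = J := by grind
    have hse : sp v U ({e} : Finset ι) = U ⊔ span F {v e} := by
      rw [Finset.coe_singleton, ← insert_empty_eq, sp_insert, sp_empty]
    have hins : sp v (U ⊔ span F {v₀}) ↑(insert e J) =
        sp v (U ⊔ span F {v₀}) J ⊔ span F {v e} := by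
      rw [Finset.coe_insert, sp_insert, sp_sup]
    have hconn : Conn v v₀ U (insert e J) →
        finrank F ↑(sp v (U ⊔ span F {v₀}) J ⊔ span F {v e}) + finrank F U <
          finrank F ↑(U ⊔ span F {v e}) + finrank F (sp v (U ⊔ span F {v₀}) J) := by
      intro h
      have := h.2 {e} (by simp) (by simp)
      rwa [hJe, hse, hins] at this
    rw [hins]
    by_cases heU : v e ∈ U
    · rw [nbcSum_of_mem (Finset.mem_insert_self _ _) heU, mul_zero]
      refine ⟨le_rfl, fun h => ?_⟩
      have := hconn h
      rw [sup_singleton_of_mem heU] at this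
      have := Submodule.finrank_mono (le_sup_left : sp v (U ⊔ span F {v₀}) J ≤ _ ⊔ span F {v e})
      omega
    · rw [nbcSum_insert hJ heU]
      by_cases hco : v e ∈ sp v (U ⊔ span F {v₀}) J
      · rw [sup_singleton_of_mem hco]
        have h1 := ih U
        have h2 := ih (U ⊔ span F {v e})
        have h3 : sp v (U ⊔ span F {v e} ⊔ span F {v₀}) J = sp v (U ⊔ span F {v₀}) J := by
          rw [sup_assoc, sup_comm (span F {v e}), ← sup_assoc, sp_sup, sup_singleton_of_mem hco]
        rw [h3, finrank_sup_singleton heU] at h2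
        -- Contraction raises the rank of the base space by one and preserves the total rank, so the
        -- sign change cancels the minus sign of the recursion.
        have h4 : ∀ a b : ℤ, ∀ r u : ℕ, (-1) ^ (r + u + 1) * (a - b) =
            (-1) ^ (r + u + 1) * a + (-1) ^ (r + (u + 1) + 1) * b := by
          intros; ring
        rw [h4]
        refine ⟨add_nonneg h1.1 h2.1, fun h => ?_⟩
        rcases h.delete_or_contract heJ with h | h
        · exact add_pos_of_pos_of_nonneg (h1.2 h) h2.1
        · exact add_pos_of_nonneg_of_pos h1.1 (h2.2 h)
      · rw [nbcSum_sup_coloop hco, sub_self, mul_zero]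
        refine ⟨le_rfl, fun h => ?_⟩
        have := hconn h
        rw [finrank_sup_singleton heU, finrank_sup_singleton hco] at this
        omega

/-- The alternating sum over the sets without broken circuits of a connected configuration does
not vanish. -/
theorem Conn.nbcSum_ne_zero (h : Conn v v₀ U J) : nbcSum v v₀ U J ≠ 0 := by
  intro h0
  have := (nbcSum_sign J U).2 h
  rw [h0, mul_zero] at this
  exact lt_irrefl _ this

/-- A criterion for connectedness in terms of intersections of spans. -/
lemma conn_univ [Fintype ι] (h₀ : v₀ ∉ U)
    (h : ∀ Q : Set ι, Q.Nonempty → ¬ sp v U Q ⊓ sp v (U ⊔ span F {v₀}) Qᶜ ≤ U) :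
    Conn v v₀ U (Finset.univ : Finset ι) := by
  refine ⟨h₀, fun Q _ hQ => ?_⟩
  by_contra hcon
  refine h Q hQ (Eq.ge (eq_of_le_of_finrank_le ?_ ?_))
  · exact le_inf (le_sp _ _ _) (le_sup_left.trans (le_sp _ _ _))
  · have h1 := Submodule.finrank_sup_add_finrank_inf_eq (sp v U (Q : Set ι))
      (sp v (U ⊔ span F {v₀}) (Q : Set ι)ᶜ)
    have h2 : sp v U (Q : Set ι) ⊔ sp v (U ⊔ span F {v₀}) (Q : Set ι)ᶜ =
        sp v (U ⊔ span F {v₀}) ↑(Finset.univ : Finset ι) := by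
      refine le_antisymm (sup_le (sp_mono v le_sup_left (by simp)) (sp_mono v le_rfl (by simp)))
        (sp_le v (le_sup_of_le_right (le_sp _ _ _)) fun i _ => ?_)
      by_cases hi : i ∈ (Q : Set ι)
      · exact mem_sup_left (mem_sp v hi)
      · exact mem_sup_right (mem_sp v hi)
    rw [h2] at h1
    rw [Finset.coe_sdiff, Finset.coe_univ, ← Set.compl_eq_univ_sdiff] at hcon
    rw [Finset.coe_univ] at h1
    omega

end BrokenCircuits

end OSArr

end

noncomputable section

namespace OSArr

/-! ### Broken-circuit bases and the Euler characteristic -/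

section NBCBasis

open Module Submodule

variable {K : Type*} [Field K] {F W ι : Type*} [Field F] [AddCommGroup W] [Module F W]
  {v : ι → W} {v₀ : W} {U : Submodule F W}

/-- The linear form on `ι → K` whose values on the standard basis are `1`. -/
def total (K ι : Type*) [Field K] [Fintype ι] : Module.Dual K (ι → K) :=
  ∑ i, LinearMap.proj i

open Classical in
@[simp] lemma total_single [Fintype ι] (i : ι) : total K ι (Pi.single i 1) = 1 := by
  simp [total, LinearMap.sum_apply, Pi.single_apply]

/-- The vectors `v i` for `i` in `L` satisfy a nontrivial linear relation modulo `U`. -/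
def Dep (v : ι → W) (U : Submodule F W) (L : Finset ι) : Prop :=
  ∃ a : ι → F, (∃ i ∈ L, a i ≠ 0) ∧ ∑ i ∈ L, a i • v i ∈ U

/-- A two-sided ideal of an algebra, as a linear subspace. -/
def idealSubmodule {E : Type*} [Ring E] [Algebra K E] (I : TwoSidedIdeal E) : Submodule K E :=
  I.asIdeal.restrictScalars K

@[simp] lemma mem_idealSubmodule {E : Type*} [Ring E] [Algebra K E] {I : TwoSidedIdeal E}
    {x : E} : x ∈ idealSubmodule (K := K) I ↔ x ∈ I := Iff.rfl

/-- The tail spans of `S` form a flag, and `lev i` records where `v i` leaves it. In a relation with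
distinct levels, the term of smallest level would lie in a smaller step of the flag containing all
the others. -/
lemma exists_same_level [LinearOrder ι] {S L : Finset ι} {lev : ι → WithBot ι}
    (hlev : ∀ i, v i ∉ sp v U {s | s ∈ S ∧ lev i < s} ∧
      ∀ l < lev i, v i ∈ sp v U {s | s ∈ S ∧ l < s}) (hL : Dep v U L) :
    ∃ i ∈ L, ∃ j ∈ L, i ≠ j ∧ lev i = lev j := by
  classical
  by_contra hcon
  push Not at hcon
  obtain ⟨a, ⟨k, hk, hak⟩, ha⟩ := hL
  obtain ⟨i, hi, hmin⟩ := (L.filter (a · ≠ 0)).exists_min_image lev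
    ⟨k, Finset.mem_filter.2 ⟨hk, hak⟩⟩
  rw [Finset.mem_filter] at hi
  apply (hlev i).1
  rw [← Finset.add_sum_erase L _ hi.1] at ha
  have h1 : ∑ j ∈ L.erase i, a j • v j ∈ sp v U {s | s ∈ S ∧ lev i < s} := by
    refine sum_mem fun j hj => ?_
    rw [Finset.mem_erase] at hj
    by_cases haj : a j = 0
    · simp [haj]
    · refine smul_mem _ _ ((hlev j).2 _ (lt_of_le_of_ne ?_ (hcon i hi.1 j hj.2 hj.1.symm)))
      exact hmin j (Finset.mem_filter.2 ⟨hj.2, haj⟩)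
  have h2 := sub_mem (le_sp v U {s | s ∈ S ∧ lev i < s} ha) h1
  rw [add_sub_cancel_right] at h2
  exact (smul_mem_iff _ hi.2).1 h2

variable [Fintype ι]

/-- The ideal `I` contains the relations of the Orlik-Solomon type that are needed to rewrite any
monomial in terms of monomials without broken circuits. -/
structure HasRelations (I : TwoSidedIdeal (ExteriorAlgebra K (ι → K))) (v : ι → W) (v₀ : W)
    (U : Submodule F W) : Prop where
  monom_mem : ∀ L : List ι, v₀ ∈ sp v U {i | i ∈ L} → monom K L ∈ I
  contr_mem : ∀ (i : ι) (T : List ι), T.Nodup → i ∉ T → v i ∈ sp v U {t | t ∈ T} →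
    monom K T ∈ I ∨ contr (total K ι) (monom K (i :: T)) ∈ I

variable [LinearOrder ι]

/-- The number of elements smaller than `i`. -/
def rank (i : ι) : ℕ := (Finset.univ.filter (· < i)).card

lemma rank_lt {i j : ι} (h : i < j) : rank i < rank j := by
  refine Finset.card_lt_card ((Finset.ssubset_iff_of_subset ?_).2 ⟨i, ?_, ?_⟩)
  · intro k hk
    simp only [Finset.mem_filter, Finset.mem_univ, true_and] at hk ⊢
    exact hk.trans h
  · simpa using h
  · simp

lemma rank_le {i j : ι} (h : i ≤ j) : rank i ≤ rank j := by
  rcases h.lt_or_eq with h | rfl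
  exacts [(rank_lt h).le, le_rfl]

/-- Homomorphisms that satisfy the relations of the Orlik-Solomon type vanish on `I`. -/
def OnlyRelations (I : TwoSidedIdeal (ExteriorAlgebra K (ι → K))) (v : ι → W) (v₀ : W)
    (U : Submodule F W) : Prop :=
  ∀ ρ : ExteriorAlgebra K (ι → K) →ₐ[K] ExteriorAlgebra K (ι → K),
    (∀ L : List ι, v₀ ∈ sp v U {i | i ∈ L} → ρ (monom K L) = 0) →
    (∀ L : List ι, L.Nodup → Dep v U L.toFinset → ρ (contr (total K ι) (monom K L)) = 0) →
    ∀ y ∈ I, ρ y = 0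

variable {I : TwoSidedIdeal (ExteriorAlgebra K (ι → K))}

/-- Straightening: a broken circuit is rewritten through its circuit relation, which replaces one
factor by a smaller one, so the sum of the ranks decreases. The length is preserved, as needed to
count by parity. -/
lemma HasRelations.monom_mem_span (hI : HasRelations I v v₀ U) (n : ℕ) :
    ∀ L : List ι, (L.map rank).sum = n → monom K L ∈ idealSubmodule (K := K) I ⊔
      span K {y | ∃ S : Finset ι, IsNBC v v₀ U Finset.univ S ∧ S.card = L.length ∧
        y = monom K S.toList} := by
  induction n using Nat.strong_induction_on with
  | _ n ih =>
    intro L hL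
    by_cases hnd : L.Nodup
    swap
    · rw [monom_eq_zero hnd]; exact zero_mem _
    by_cases hN : IsNBC v v₀ U Finset.univ L.toFinset
    · have hp := List.toFinset_toList hnd
      have hmem : monom K L.toFinset.toList ∈ span K {y | ∃ S : Finset ι,
          IsNBC v v₀ U Finset.univ S ∧ S.card = L.length ∧ y = monom K S.toList} :=
        subset_span ⟨_, hN, List.toFinset_card_of_nodup hnd, rfl⟩
      refine mem_sup_right ?_
      rcases monom_perm (K := K) hp with h | h
      · rwa [← h]
      · rw [h] at hmem
        simpa using neg_mem hmem
    have hset : ((L.toFinset : Finset ι) : Set ι) = {i | i ∈ L} := by ext; simp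
    by_cases h0 : v₀ ∈ sp v U {i | i ∈ L}
    · exact mem_sup_left (hI.monom_mem L h0)
    have hi : ∃ i, v i ∈ sp v U {s | s ∈ L ∧ i < s} := by
      by_contra hcon
      push Not at hcon
      refine hN ⟨Finset.subset_univ _, by rwa [hset], fun i _ => ?_⟩
      simpa using hcon i
    obtain ⟨i, hi⟩ := hi
    set T := L.filter (fun t => decide (i < t)) with hT
    set R := L.filter (fun t => !decide (i < t)) with hR
    have hperm : (T ++ R).Perm L := List.filter_append_perm _ L
    suffices h : monom K (T ++ R) ∈ idealSubmodule (K := K) I ⊔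
        span K {y | ∃ S : Finset ι, IsNBC v v₀ U Finset.univ S ∧ S.card = L.length ∧
          y = monom K S.toList} by
      rcases monom_perm (K := K) hperm with h' | h'
      · rwa [← h']
      · rw [h'] at h
        simpa using neg_mem h
    rw [monom_append]
    have hiT : v i ∈ sp v U {t | t ∈ T} := by
      simpa [hT, List.mem_filter] using hi
    rcases hI.contr_mem i T (hnd.filter _) (by simp [hT]) hiT with h | h
    · exact mem_sup_left (I.mul_mem_right _ _ h)
    · have h1 : monom K T * monom K R = contr (total K ι) (monom K (i :: T)) * monom K R +
          gen K i * contr (total K ι) (monom K T) * monom K R := by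
        rw [monom_cons, contr_gen_mul, total_single, one_smul, sub_mul, sub_add_cancel]
      rw [h1]
      refine add_mem (mem_sup_left (I.mul_mem_right _ _ h)) ?_
      refine span_induction (p := fun y _ => gen K i * y * monom K R ∈ _) ?_ ?_ ?_ ?_
        (contr_monom_mem (K := K) (total K ι) T)
      · rintro _ ⟨c, M, hc, -, rfl⟩
        rw [← monom_cons, ← monom_append]
        have hlen : (i :: M ++ R).length = L.length := by
          rw [← hperm.length_eq, List.length_append, List.length_append, hc.length_eq]
          rfl
        rw [← hlen]
        refine ih _ ?_ _ rfl
        have hic : i < c := by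
          have : c ∈ T := hc.mem_iff.2 (by simp)
          simpa [hT] using (List.mem_filter.1 this).2
        have := rank_lt hic
        have e1 := (hperm.map rank).sum_eq
        have e2 := (hc.map rank).sum_eq
        simp only [List.map_append, List.sum_append, List.map_cons, List.sum_cons] at e1 e2 ⊢
        omega
      · simp
      · intro x y _ _ hx hy
        rw [mul_add, add_mul]; exact add_mem hx hy
      · intro a x _ hx
        rw [mul_smul_comm, smul_mul_assoc]; exact smul_mem _ _ hx

/-- The level of each index with respect to the flag of the tails of `S`. -/
lemma exists_level {S : Finset ι} (hS : IsNBC v v₀ U Finset.univ S) :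
    ∃ lev : ι → WithBot ι, ∀ i, lev i ≤ i ∧ v i ∉ sp v U {s | s ∈ S ∧ lev i < s} ∧
      ∀ l < lev i, v i ∈ sp v U {s | s ∈ S ∧ l < s} := by
  have : ∀ i : ι, ∃ l : WithBot ι, l ≤ i ∧ v i ∉ sp v U {s | s ∈ S ∧ l < s} ∧
      ∀ l' < l, v i ∈ sp v U {s | s ∈ S ∧ l' < s} := by
    intro i
    -- The absence of broken circuits puts `i` itself in this set, so its least element is at most
    -- `i`. The value `⊥` means that `v i` is outside the span of all of `S`.
    have hi : (i : WithBot ι) ∈ {l : WithBot ι | v i ∉ sp v U {s | s ∈ S ∧ l < s}} := by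
      simpa using hS.2.2 i (Finset.mem_univ i)
    obtain ⟨l, hl, hmin⟩ := (wellFounded_lt (α := WithBot ι)).has_min _ ⟨_, hi⟩
    refine ⟨l, not_lt.1 (hmin _ hi), hl, fun l' hl' => ?_⟩
    by_contra h
    exact hmin l' h hl'
  exact ⟨fun i => (this i).choose, fun i => (this i).choose_spec⟩

/-- The generator attached to a level. -/
def levelGen (K : Type*) [Field K] {ι : Type*} : WithBot ι → (ι → K)
  | ⊥ => 0
  | (j : ι) => by classical exact Pi.single j 1

/-- The endomorphism of the exterior algebra that replaces each generator by that of its level. -/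
def levelHom (K : Type*) [Field K] (lev : ι → WithBot ι) :
    ExteriorAlgebra K (ι → K) →ₐ[K] ExteriorAlgebra K (ι → K) :=
  ExteriorAlgebra.map ((Pi.basisFun K ι).constr K fun i => levelGen K (lev i))

lemma levelHom_gen (lev : ι → WithBot ι) (i : ι) :
    levelHom K lev (gen K i) = ExteriorAlgebra.ι K (levelGen K (lev i)) := by
  rw [levelHom, gen, ExteriorAlgebra.map_apply_ι]
  congr 1
  have := (Pi.basisFun K ι).constr_basis K (fun i => levelGen K (lev i)) i
  rw [Pi.basisFun_apply] at this
  convert this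

lemma levelHom_monom_eq_zero {lev : ι → WithBot ι} {L : List ι} {i : ι} (hi : i ∈ L)
    (h : lev i = ⊥) : levelHom K lev (monom K L) = 0 := by
  rw [monom, map_list_prod, List.prod_eq_zero]
  rw [List.map_map, List.mem_map]
  refine ⟨i, hi, ?_⟩
  rw [Function.comp_apply, levelHom_gen, h]
  simp [levelGen]

lemma levelHom_monom {lev : ι → WithBot ι} {l : ι → ι} {L : List ι}
    (h : ∀ i ∈ L, lev i = l i) : levelHom K lev (monom K L) = monom K (L.map l) := by
  rw [monom, map_list_prod, monom, List.map_map, List.map_map]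
  congr 1
  refine List.map_congr_left fun i hi => ?_
  rw [Function.comp_apply, levelHom_gen, h i hi]
  rfl

/-- After substitution two factors coincide, and the contraction of a product containing `u * u`
vanishes because its two terms carrying a single `u` cancel. -/
lemma levelHom_contr {lev : ι → WithBot ι} {L : List ι} {i j : ι} (hi : i ∈ L) (hj : j ∈ L)
    (hij : i ≠ j) (h : lev i = lev j) :
    levelHom K lev (contr (total K ι) (monom K L)) = 0 := by
  have hp : L.Perm (i :: j :: (L.erase i).erase j) := by
    refine (List.perm_cons_erase hi).trans (List.Perm.cons _ (List.perm_cons_erase ?_))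
    exact (List.mem_erase_of_ne hij.symm).2 hj
  have h0 : levelHom K lev (contr (total K ι) (monom K (i :: j :: (L.erase i).erase j))) = 0 := by
    rw [monom_cons, contr_gen_mul, monom_cons, contr_gen_mul]
    simp only [total_single, one_smul, map_sub, map_mul, levelHom_gen, h, mul_sub]
    rw [← mul_assoc _ _ (levelHom K lev (contr _ _)), ExteriorAlgebra.ι_sq_zero]
    simp
  rcases monom_perm (K := K) hp with h' | h'
  · rw [h', h0]
  · rw [h', map_neg, map_neg, h0, neg_zero]

lemma coef_levelHom_self {S : Finset ι} {lev : ι → WithBot ι} (h : ∀ i ∈ S, lev i = i) :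
    coef K S.toList (levelHom K lev (monom K S.toList)) = 1 := by
  rw [levelHom_monom (l := id) (by simpa using h), List.map_id,
    coef_monom_self S.nodup_toList]

/-- Triangularity: levels never exceed indices, so a monomial can only be sent to one of no larger
rank sum, with equality only if it is fixed. -/
lemma coef_levelHom {S T : Finset ι} {lev : ι → WithBot ι} (h : ∀ i, lev i ≤ i)
    (hST : coef K S.toList (levelHom K lev (monom K T.toList)) ≠ 0) :
    T = S ∨ ∑ i ∈ S, rank i < ∑ i ∈ T, rank i := by
  have hbot : ∀ i ∈ T, lev i ≠ ⊥ := by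
    intro i hi hb
    rw [levelHom_monom_eq_zero (Finset.mem_toList.2 hi) hb, map_zero] at hST
    exact hST rfl
  let l : ι → ι := fun i => (lev i).unbotD i
  have hl : ∀ i ∈ T, lev i = l i := by
    intro i hi
    obtain ⟨j, hj⟩ := WithBot.ne_bot_iff_exists.1 (hbot i hi)
    simp [l, ← hj]
  have hle : ∀ i ∈ T, l i ≤ i := by
    intro i hi
    have := h i
    rw [hl i hi] at this
    exact_mod_cast this
  rw [levelHom_monom (l := l) (by simpa using hl)] at hST
  have hperm := coef_monom_perm _ _ hST
  by_cases heq : ∀ i ∈ T, l i = i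
  · left
    have : T.toList.map l = T.toList := by
      conv_rhs => rw [← List.map_id T.toList]
      exact List.map_congr_left (by simpa using heq)
    rw [this] at hperm
    ext i
    rw [← Finset.mem_toList, hperm.mem_iff, Finset.mem_toList]
  · right
    push Not at heq
    obtain ⟨i, hi, hne⟩ := heq
    have h1 : ∑ i ∈ S, rank i = ∑ i ∈ T, rank (l i) := by
      rw [← Finset.sum_map_toList S, ← Finset.sum_map_toList T, ← (hperm.map rank).sum_eq,
        List.map_map]
      rfl
    rw [h1]
    exact Finset.sum_lt_sum (fun j hj => rank_le (hle j hj))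
      ⟨i, hi, rank_lt (lt_of_le_of_ne (hle i hi) hne)⟩

/-- For `S` of largest rank sum in a relation, the level homomorphism of `S` kills `I`, fixes the
monomial of `S`, and sends no other monomial occurring in the relation to a multiple of it. Hence
the coefficient of `S` is zero. -/
lemma OnlyRelations.linearIndependent (hI : OnlyRelations I v v₀ U) :
    LinearIndependent K (fun S : {S : Finset ι // IsNBC v v₀ U Finset.univ S} =>
      (idealSubmodule (K := K) I).mkQ (monom K S.1.toList)) := by
  classical
  rw [Fintype.linearIndependent_iff]
  intro c hc
  by_contra hcon
  push Not at hcon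
  obtain ⟨S₀, hS₀⟩ := hcon
  obtain ⟨S, hS, hmax⟩ := (Finset.univ.filter (c · ≠ 0)).exists_max_image
    (fun S => ∑ i ∈ S.1, rank i) ⟨S₀, by simpa using hS₀⟩
  simp only [Finset.mem_filter, Finset.mem_univ, true_and] at hS hmax
  obtain ⟨lev, hlev⟩ := exists_level S.2
  have hmem : ∑ T, c T • monom K T.1.toList ∈ I := by
    rw [← mem_idealSubmodule (K := K), ← Submodule.Quotient.mk_eq_zero,
      ← Submodule.mkQ_apply, map_sum]
    simpa using hc
  have hz := hI (levelHom K lev) ?_ ?_ _ hmem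
  · have hself : ∀ i ∈ S.1, lev i = i := by
      intro i hi
      refine (hlev i).1.antisymm (not_lt.1 fun hlt => (hlev i).2.1 (mem_sp v ⟨hi, hlt⟩))
    apply hS
    have := congrArg (coef K S.1.toList) hz
    rw [map_sum, map_sum, map_zero, Finset.sum_eq_single S] at this
    · simpa [coef_levelHom_self hself] using this
    · intro T _ hTS
      by_cases hT : c T = 0
      · simp [hT]
      · rw [map_smul, map_smul]
        by_contra hne
        rcases coef_levelHom (fun i => (hlev i).1) (right_ne_zero_of_smul hne) with h | h
        · exact hTS (Subtype.ext h)
        · exact absurd (hmax T hT) (not_le.2 h)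
    · simp
  -- Since `v₀` is not in the span of `S`, some `i ∈ L` must lie outside that span; its level is `⊥`
  -- and its generator is sent to zero.
  · intro L hL
    by_contra hne
    apply S.2.2.1
    refine sp_le v (le_sp v _ _) (fun i hi => ?_) hL
    have hbot : lev i ≠ ⊥ := fun h => hne (levelHom_monom_eq_zero hi h)
    have := (hlev i).2.2 ⊥ (bot_lt_iff_ne_bot.2 hbot)
    simpa [WithBot.bot_lt_coe] using this
  · intro L _ hdep
    obtain ⟨i, hi, j, hj, hij, h⟩ := exists_same_level (fun i => (hlev i).2) hdep
    exact levelHom_contr (by simpa using hi) (by simpa using hj) hij h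

/-- An odd exact operator is exact separately at both parities; rank–nullity on the two restrictions
then gives equal dimensions. -/
lemma finrank_eq_of_ker_eq_range {Q : Type*} [AddCommGroup Q] [Module K Q]
    [FiniteDimensional K Q] (T : Q →ₗ[K] Q) {M₀ M₁ : Submodule K Q} (hM : IsCompl M₀ M₁)
    (h₀ : ∀ y ∈ M₀, T y ∈ M₁) (h₁ : ∀ y ∈ M₁, T y ∈ M₀) (hT : LinearMap.ker T = LinearMap.range T) :
    finrank K M₀ = finrank K M₁ := by
  have key : ∀ {A B : Submodule K Q} (_ : IsCompl A B) (hA : ∀ y ∈ A, T y ∈ B)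
      (hB : ∀ y ∈ B, T y ∈ A), LinearMap.ker (T.restrict hA) = LinearMap.range (T.restrict hB) := by
    intro A B hAB hA hB
    ext ⟨y, hy⟩
    simp only [LinearMap.mem_ker, LinearMap.mem_range, Subtype.ext_iff, LinearMap.restrict_apply,
      Subtype.exists, ZeroMemClass.coe_zero]
    constructor
    · intro h
      have h' : y ∈ LinearMap.range T := hT ▸ LinearMap.mem_ker.2 h
      obtain ⟨z, rfl⟩ := h'
      obtain ⟨a, ha, b, hb, rfl⟩ := mem_sup.1 (hAB.sup_eq_top.symm ▸ mem_top : z ∈ A ⊔ B)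
      refine ⟨b, hb, ?_⟩
      have h3 : T a ∈ A := by
        have := sub_mem hy (hB b hb)
        rwa [map_add, add_sub_cancel_right] at this
      have h4 : T a = 0 := (disjoint_def.1 hAB.disjoint) _ h3 (hA a ha)
      rw [map_add, h4, zero_add]
    · rintro ⟨z, hz, rfl⟩
      have : T z ∈ LinearMap.ker T := hT.symm ▸ LinearMap.mem_range_self T z
      exact this
  have e0 := LinearMap.finrank_range_add_finrank_ker (T.restrict h₀)
  have e1 := LinearMap.finrank_range_add_finrank_ker (T.restrict h₁)
  rw [key hM h₀ h₁] at e0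
  rw [key hM.symm h₁ h₀] at e1
  omega

/-- If multiplication by `x` is exact on the quotient by `I`, then the Euler characteristic of the
quotient vanishes. -/
theorem nbcSum_eq_zero (h₁ : HasRelations I v v₀ U) (h₂ : OnlyRelations I v v₀ U) {x : ι → K}
    (hx : ∀ a, ExteriorAlgebra.ι K x * a ∈ I → ∃ b, a - ExteriorAlgebra.ι K x * b ∈ I) :
    nbcSum v v₀ U Finset.univ = 0 := by
  classical
  let N := {S : Finset ι // IsNBC v v₀ U Finset.univ S}
  let J : Submodule K (ExteriorAlgebra K (ι → K)) := idealSubmodule I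
  let b : N → _ ⧸ J := fun S => J.mkQ (monom K S.1.toList)
  have hb : LinearIndependent K b := h₂.linearIndependent
  let P : Fin 2 → Set N := fun p => {S | S.1.card % 2 = p}
  let M : Fin 2 → Submodule K (_ ⧸ J) := fun p => span K (b '' P p)
  have hmon : ∀ (p : Fin 2) (L : List ι), L.length % 2 = p → J.mkQ (monom K L) ∈ M p := by
    intro p L hL
    obtain ⟨y, hy, z, hz, hyz⟩ := mem_sup.1 (h₁.monom_mem_span _ L rfl)
    have h0 : J.mkQ y = 0 := (Submodule.Quotient.mk_eq_zero J).2 hy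
    rw [← hyz, map_add, h0, zero_add]
    refine span_induction (p := fun z _ => J.mkQ z ∈ M p) ?_ ?_ ?_ ?_ hz
    · rintro _ ⟨S, hS, hc, rfl⟩
      exact subset_span ⟨⟨S, hS⟩, by simp only [P, Set.mem_ofPred_eq, hc, hL], rfl⟩
    · simp
    · intro x y _ _ hx hy
      rw [map_add]; exact add_mem hx hy
    · intro a x _ hx
      rw [map_smul]; exact smul_mem _ _ hx
  let T : (_ ⧸ J) →ₗ[K] (_ ⧸ J) := J.mapQ J (LinearMap.mulLeft K (ExteriorAlgebra.ι K x))
    (fun y hy => I.mul_mem_left _ _ hy)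
  have hT : ∀ y, T (J.mkQ y) = J.mkQ (ExteriorAlgebra.ι K x * y) := fun y => rfl
  have hTM : ∀ p q : Fin 2, (p : ℕ) + q = 1 → ∀ y ∈ M p, T y ∈ M q := by
    intro p q hpq y hy
    refine span_induction (p := fun y _ => T y ∈ M q) ?_ ?_ ?_ ?_ hy
    · rintro _ ⟨S, hS, rfl⟩
      rw [hT, ι_eq_sum, Finset.sum_mul, map_sum]
      refine sum_mem fun i _ => ?_
      rw [smul_mul_assoc, map_smul, ← monom_cons]
      refine smul_mem _ _ (hmon q _ ?_)
      simp only [P, Set.mem_ofPred_eq] at hS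
      rw [List.length_cons, Finset.length_toList]
      omega
    · simp
    · intro x y _ _ hx hy
      rw [map_add]; exact add_mem hx hy
    · intro a x _ hx
      rw [map_smul]; exact smul_mem _ _ hx
  have htop : M 0 ⊔ M 1 = ⊤ := by
    rw [eq_top_iff, ← J.range_mkQ, LinearMap.range_eq_map, ← monom_span_top, map_span, span_le]
    rintro _ ⟨_, ⟨L, rfl⟩, rfl⟩
    rcases Nat.mod_two_eq_zero_or_one L.length with h | h
    · exact mem_sup_left (hmon 0 L h)
    · exact mem_sup_right (hmon 1 L h)
  have hcompl : IsCompl (M 0) (M 1) := by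
    refine ⟨hb.disjoint_span_image (Set.disjoint_left.2 fun S h h' => ?_),
      codisjoint_iff.2 htop⟩
    simp only [P, Set.mem_ofPred_eq] at h h'
    omega
  have hker : LinearMap.ker T = LinearMap.range T := by
    ext y
    obtain ⟨y, rfl⟩ := J.mkQ_surjective y
    rw [LinearMap.mem_ker, LinearMap.mem_range, hT]
    constructor
    · intro h
      obtain ⟨z, hz⟩ := hx y ((Submodule.Quotient.mk_eq_zero J).1 h)
      refine ⟨J.mkQ z, ?_⟩
      rw [hT, ← sub_eq_zero, ← map_sub, ← neg_sub, map_neg]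
      exact neg_eq_zero.2 ((Submodule.Quotient.mk_eq_zero J).2 hz)
    · rintro ⟨z, hz⟩
      obtain ⟨z, rfl⟩ := J.mkQ_surjective z
      rw [← hT, ← hz, hT, hT, ← mul_assoc, ExteriorAlgebra.ι_sq_zero, zero_mul, map_zero]
  have hfin : FiniteDimensional K (_ ⧸ J) := by
    refine ⟨⟨(Finset.univ.image b), ?_⟩⟩
    rw [eq_top_iff, ← htop]
    simp only [Finset.coe_image, Finset.coe_univ]
    exact sup_le (span_mono (Set.image_mono (Set.subset_univ _)))
      (span_mono (Set.image_mono (Set.subset_univ _)))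
  have hfr : ∀ p, finrank K (M p) = (Finset.univ.filter fun S : N => S.1.card % 2 = p).card := by
    intro p
    have hli : LinearIndependent K (fun S : P p => b S) := hb.comp _ Subtype.val_injective
    have := finrank_span_eq_card hli
    rw [← Set.image_eq_range] at this
    rw [this, Fintype.card_subtype]
    rfl
  have hmain := finrank_eq_of_ker_eq_range T hcompl (hTM 0 1 rfl) (hTM 1 0 rfl) hker
  rw [hfr, hfr] at hmain
  have hsum : nbcSum v v₀ U Finset.univ = ∑ S : N, (-1) ^ S.1.card := by
    rw [nbcSum, ← Finset.sum_filter, Finset.powerset_univ,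
      ← Finset.sum_subtype_eq_sum_filter, Finset.subtype_univ]
  have heven : ∑ S ∈ Finset.univ.filter (fun S : N => S.1.card % 2 = 0), (-1 : ℤ) ^ S.1.card =
      (Finset.univ.filter (fun S : N => S.1.card % 2 = 0)).card := by
    rw [Finset.sum_congr rfl (g := fun _ => (1 : ℤ)), Finset.sum_const, nsmul_one]
    intro S hS
    exact Even.neg_one_pow (Nat.even_iff.2 (Finset.mem_filter.1 hS).2)
  have hodd : ∑ S ∈ Finset.univ.filter (fun S : N => ¬ S.1.card % 2 = 0), (-1 : ℤ) ^ S.1.card =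
      - (Finset.univ.filter (fun S : N => S.1.card % 2 = 1)).card := by
    rw [Finset.sum_congr (s₂ := Finset.univ.filter (fun S : N => S.1.card % 2 = 1))
      (g := fun _ => (-1 : ℤ)) (by ext S; simp), Finset.sum_const, smul_neg, nsmul_one]
    intro S hS
    exact Odd.neg_one_pow (Nat.odd_iff.2 (Finset.mem_filter.1 hS).2)
  rw [hsum, ← Finset.sum_filter_add_sum_filter_not _ (fun S : N => S.1.card % 2 = 0), heven, hodd,
    add_neg_eq_zero]
  exact_mod_cast hmain

end NBCBasis

end OSArr

end

noncomputable section

namespace OSArr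

/-! ### Exactness of multiplication and contracting homotopies -/

section Exactness

variable {K : Type*} [Field K] {ι : Type*}

/-- The grade involution of the exterior algebra. -/
def gradeInv (K : Type*) [Field K] (ι : Type*) :
    ExteriorAlgebra K (ι → K) →ₐ[K] ExteriorAlgebra K (ι → K) :=
  CliffordAlgebra.involute (Q := (0 : QuadraticForm K (ι → K)))

lemma gradeInv_ι (x : ι → K) :
    gradeInv K ι (ExteriorAlgebra.ι K x) = - ExteriorAlgebra.ι K x :=
  CliffordAlgebra.involute_ι _

lemma gradeInv_ι_mul (x : ι → K) (y : ExteriorAlgebra K (ι → K)) :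
    gradeInv K ι (ExteriorAlgebra.ι K x * y) = - (ExteriorAlgebra.ι K x * gradeInv K ι y) := by
  rw [map_mul, gradeInv_ι, neg_mul]

lemma leftInduction {P : ExteriorAlgebra K (ι → K) → Prop}
    (algebraMap : ∀ r : K, P (algebraMap K _ r)) (add : ∀ x y, P x → P y → P (x + y))
    (ι_mul : ∀ y x, P y → P (ExteriorAlgebra.ι K x * y)) (y) : P y :=
  CliffordAlgebra.left_induction (Q := (0 : QuadraticForm K (ι → K))) algebraMap add ι_mul y

lemma gradeInv_monom (L : List ι) :
    gradeInv K ι (monom K L) = monom K L ∨ gradeInv K ι (monom K L) = - monom K L := by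
  induction L with
  | nil => simp
  | cons i L ih =>
    have : gradeInv K ι (monom K (i :: L)) = - (gen K i * gradeInv K ι (monom K L)) := by
      rw [monom_cons]; exact gradeInv_ι_mul _ _
    rw [this, monom_cons]
    rcases ih with h | h <;> simp [h]

lemma gradeInv_contr (θ : Module.Dual K (ι → K)) (y : ExteriorAlgebra K (ι → K)) :
    gradeInv K ι (contr θ y) = - contr θ (gradeInv K ι y) := by
  induction y using leftInduction with
  | algebraMap r => simp [contr_algebraMap]
  | add x y hx hy => simp only [map_add, hx, hy, neg_add]
  | ι_mul y x hy =>
    rw [contr_ι_mul, map_sub, map_smul, gradeInv_ι_mul, gradeInv_ι_mul, map_neg, contr_ι_mul, hy]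
    simp

lemma contr_mul (θ : Module.Dual K (ι → K)) (a y : ExteriorAlgebra K (ι → K)) :
    contr θ (a * y) = contr θ a * y + gradeInv K ι a * contr θ y := by
  induction a using leftInduction with
  | algebraMap r =>
    rw [contr_algebraMap, AlgHom.commutes, ← Algebra.smul_def, ← Algebra.smul_def, map_smul]
    simp
  | add a b ha hb => simp only [map_add, add_mul, ha, hb]; abel
  | ι_mul a x ha =>
    rw [mul_assoc, contr_ι_mul, contr_ι_mul, ha, gradeInv_ι_mul, sub_mul, smul_mul_assoc, mul_add,
      neg_mul, mul_assoc, mul_assoc]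
    abel

lemma ι_mul_eq_gradeInv_mul (x : ι → K) (y : ExteriorAlgebra K (ι → K)) :
    ExteriorAlgebra.ι K x * y = gradeInv K ι y * ExteriorAlgebra.ι K x := by
  induction y using leftInduction with
  | algebraMap r => rw [AlgHom.commutes, Algebra.commutes]
  | add a b ha hb => simp only [map_add, add_mul, mul_add, ha, hb]
  | ι_mul y z hy =>
    rw [← mul_assoc, ι_mul_comm, neg_mul, mul_assoc, hy, gradeInv_ι_mul, neg_mul, mul_assoc]

variable {G : Set (ExteriorAlgebra K (ι → K))}

lemma TwoSidedIdeal.smul_mem' {E : Type*} [Ring E] [Algebra K E] (I : TwoSidedIdeal E) (c : K)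
    {y : E} (hy : y ∈ I) : c • y ∈ I := by
  rw [Algebra.smul_def]; exact I.mul_mem_left _ _ hy

/-- A contraction preserves a two-sided ideal as soon as it maps homogeneous generators to it. -/
lemma contr_mem_span {θ : Module.Dual K (ι → K)}
    (hG : ∀ g ∈ G, gradeInv K ι g ∈ TwoSidedIdeal.span G)
    (hθ : ∀ g ∈ G, contr θ g ∈ TwoSidedIdeal.span G) {y : ExteriorAlgebra K (ι → K)}
    (hy : y ∈ TwoSidedIdeal.span G) : contr θ y ∈ TwoSidedIdeal.span G := by
  set I := TwoSidedIdeal.span G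
  suffices h : gradeInv K ι y ∈ I ∧ contr θ y ∈ I from h.2
  induction hy using TwoSidedIdeal.span_induction with
  | mem g hg => exact ⟨hG g hg, hθ g hg⟩
  | zero => simp
  | add x y _ _ hx hy =>
    rw [map_add, map_add]; exact ⟨I.add_mem hx.1 hy.1, I.add_mem hx.2 hy.2⟩
  | neg x _ hx => rw [map_neg, map_neg]; exact ⟨I.neg_mem hx.1, I.neg_mem hx.2⟩
  | left_absorb a x hxI hx =>
    rw [map_mul, contr_mul]
    exact ⟨I.mul_mem_left _ _ hx.1, I.add_mem (I.mul_mem_left _ _ hxI) (I.mul_mem_left _ _ hx.2)⟩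
  | right_absorb a x hxI hx =>
    rw [map_mul, contr_mul]
    exact ⟨I.mul_mem_right _ _ hx.1,
      I.add_mem (I.mul_mem_right _ _ hx.2) (I.mul_mem_right _ _ hx.1)⟩

/-- Multiplication by `x` is exact on the quotient by `I`. -/
def ExactOn (I : TwoSidedIdeal (ExteriorAlgebra K (ι → K))) (x : ι → K) : Prop :=
  ∀ a, ExteriorAlgebra.ι K x * a ∈ I → ∃ b, a - ExteriorAlgebra.ι K x * b ∈ I

/-- The antiderivation rule says that contraction by `θ` is a homotopy between zero and
multiplication by the scalar `θ x`. -/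
lemma exactOn_of_ne_zero {I : TwoSidedIdeal (ExteriorAlgebra K (ι → K))}
    {θ : Module.Dual K (ι → K)} (hθ : ∀ y ∈ I, contr θ y ∈ I) {x : ι → K} (hx : θ x ≠ 0) :
    ExactOn I x := by
  intro a ha
  refine ⟨(θ x)⁻¹ • contr θ a, ?_⟩
  have h := TwoSidedIdeal.smul_mem' I (θ x)⁻¹ (hθ _ ha)
  rwa [contr_ι_mul, smul_sub, smul_smul, inv_mul_cancel₀ hx, one_smul, ← mul_smul_comm] at h

/-- Multiplication by `e` kills the new generator, since `e * e = 0` and `e` commutes with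
everything up to the grade involution. -/
lemma ι_mul_mem_of_mem_span_insert {e : ι → K} {y : ExteriorAlgebra K (ι → K)}
    (hy : y ∈ TwoSidedIdeal.span (insert (ExteriorAlgebra.ι K e) G)) :
    ExteriorAlgebra.ι K e * y ∈ TwoSidedIdeal.span G := by
  set I := TwoSidedIdeal.span G
  induction hy using TwoSidedIdeal.span_induction with
  | mem g hg =>
    rcases hg with rfl | hg
    · rw [ExteriorAlgebra.ι_sq_zero]; exact I.zero_mem
    · exact I.mul_mem_left _ _ (TwoSidedIdeal.subset_span hg)
  | zero => rw [mul_zero]; exact I.zero_mem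
  | add x y _ _ hx hy => rw [mul_add]; exact I.add_mem hx hy
  | neg x _ hx => rw [mul_neg]; exact I.neg_mem hx
  | left_absorb a x _ hx =>
    rw [← mul_assoc, ι_mul_eq_gradeInv_mul, mul_assoc]; exact I.mul_mem_left _ _ hx
  | right_absorb a x _ hx => rw [← mul_assoc]; exact I.mul_mem_right _ _ hx

/-- If `x` is annihilated by a contraction preserving the ideal, then exactness of `x` is inherited
by the quotient by a further element of degree one on which the contraction takes the value `1`. -/
lemma ExactOn.span_insert {θ : Module.Dual K (ι → K)}
    (hθ : ∀ y ∈ TwoSidedIdeal.span G, contr θ y ∈ TwoSidedIdeal.span G) {x e : ι → K}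
    (hx : θ x = 0) (he : θ e = 1) (h : ExactOn (TwoSidedIdeal.span G) x) :
    ExactOn (TwoSidedIdeal.span (insert (ExteriorAlgebra.ι K e) G)) x := by
  intro a ha
  have hle : TwoSidedIdeal.span G ≤ TwoSidedIdeal.span (insert (ExteriorAlgebra.ι K e) G) :=
    TwoSidedIdeal.span_mono (Set.subset_insert _ _)
  have h1 := hθ _ (ι_mul_mem_of_mem_span_insert ha)
  -- Thus `x` annihilates `contr θ (e * a)` modulo the old ideal. This element is `a` modulo the new
  -- one, so exactness for the old ideal can be applied to it.
  have h2 : contr θ (ExteriorAlgebra.ι K e * (ExteriorAlgebra.ι K x * a)) =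
      ExteriorAlgebra.ι K x * contr θ (ExteriorAlgebra.ι K e * a) := by
    rw [← mul_assoc, ι_mul_comm, neg_mul, map_neg, mul_assoc, contr_ι_mul, hx]
    simp
  rw [h2] at h1
  obtain ⟨b, hb⟩ := h _ h1
  refine ⟨b, ?_⟩
  rw [contr_ι_mul, he, one_smul] at hb
  have h3 : ExteriorAlgebra.ι K e * contr θ a ∈
      TwoSidedIdeal.span (insert (ExteriorAlgebra.ι K e) G) :=
    TwoSidedIdeal.mul_mem_right _ _ _ (TwoSidedIdeal.subset_span (Set.mem_insert _ _))
  have := TwoSidedIdeal.add_mem _ (hle hb) h3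
  convert this using 1
  abel

end Exactness

end OSArr

end

noncomputable section

namespace OSArr

/-! ### Equations of hyperplanes and linear dependence -/

section Forms

open Module Submodule

variable {ℓ : ℕ}

lemma mem_inter {S : Finset (AffineSubspace ℂ (Space ℓ))} {p : Space ℓ} :
    p ∈ inter S ↔ ∀ H ∈ S, p ∈ H := by
  classical
  induction S using Finset.induction_on with
  | empty => simp [inter]
  | insert H S _ ih =>
    rw [inter, Finset.inf_insert, AffineSubspace.mem_inf_iff]
    change p ∈ H ∧ p ∈ inter S ↔ _
    rw [ih, Finset.forall_mem_insert]

variable (A : Arrangement ℓ)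

/-- A linear form that is constant on the hyperplane `H`. -/
def form (H : A.hyperplanes) : Dual ℂ (Space ℓ) := (A.isAffineHyperplane H.1 H.2).choose

/-- The value of `form A H` on `H`. -/
def level (H : A.hyperplanes) : ℂ := (A.isAffineHyperplane H.1 H.2).choose_spec.choose

lemma form_ne_zero (H : A.hyperplanes) : form A H ≠ 0 :=
  (A.isAffineHyperplane H.1 H.2).choose_spec.choose_spec.1

lemma mem_hyperplane (H : A.hyperplanes) (p : Space ℓ) : p ∈ H.1 ↔ form A H p = level A H :=
  (A.isAffineHyperplane H.1 H.2).choose_spec.choose_spec.2 p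

/-- The coefficients of an equation of `H`, a linear form together with a constant. -/
def vec (H : A.hyperplanes) : Dual ℂ (Space ℓ) × ℂ := (form A H, level A H)

/-- The coefficients of the equation `0 = 1` of the hyperplane at infinity. -/
def vecInf (ℓ : ℕ) : Dual ℂ (Space ℓ) × ℂ := (0, 1)

lemma vecInf_ne_zero : vecInf ℓ ≠ 0 := fun h => one_ne_zero (congrArg Prod.snd h)

lemma vec_ne_zero (H : A.hyperplanes) : vec A H ≠ 0 :=
  fun h => form_ne_zero A H (congrArg Prod.fst h)

variable {A}

lemma mem_span_vec_apply {X : Set A.hyperplanes} {p : Space ℓ}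
    (hp : ∀ H ∈ X, form A H p = level A H) {w : Dual ℂ (Space ℓ) × ℂ}
    (hw : w ∈ span ℂ (vec A '' X)) : w.1 p = w.2 := by
  refine span_induction (p := fun w _ => w.1 p = w.2) ?_ ?_ ?_ ?_ hw
  · rintro _ ⟨H, hH, rfl⟩
    exact hp H hH
  · simp
  · intro x y _ _ hx hy
    simp [hx, hy]
  · intro a x _ hx
    simp [hx]

/-- Hyperplanes have a common point if and only if their equations are consistent. -/
lemma vecInf_notMem_span_iff {X : Set A.hyperplanes} :
    vecInf ℓ ∉ span ℂ (vec A '' X) ↔ ∃ p, ∀ H ∈ X, form A H p = level A H := by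
  constructor
  · intro h
    obtain ⟨φ, hφ, hker⟩ := exists_le_ker_of_notMem h
    let p := (evalEquiv ℂ (Space ℓ)).symm (φ ∘ₗ LinearMap.inl ℂ _ _)
    have hp : ∀ f : Dual ℂ (Space ℓ), f p = φ (f, 0) := by
      intro f
      have := LinearMap.congr_fun
        ((evalEquiv ℂ (Space ℓ)).apply_symm_apply (φ ∘ₗ LinearMap.inl ℂ _ _)) f
      exact this
    -- The functional `φ` kills each `(f, c)`, that is, `f p + c * φ (vecInf ℓ) = 0`; dividing by
    -- `-φ (vecInf ℓ)` yields a common solution.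
    refine ⟨-(φ (vecInf ℓ))⁻¹ • p, fun H hH => ?_⟩
    have h1 : φ (vec A H) = 0 := hker (subset_span ⟨H, hH, rfl⟩)
    have h2 : vec A H = (form A H, 0) + level A H • vecInf ℓ := by
      simp [vec, vecInf]
    rw [h2, map_add, map_smul, ← hp, smul_eq_mul] at h1
    rw [map_smul, smul_eq_mul]
    field_simp
    linear_combination -h1
  · rintro ⟨p, hp⟩ h
    have := mem_span_vec_apply hp h
    simp [vecInf] at this

/-- The hyperplanes of `A` in `S`, as a set of affine subspaces. -/
def hyps (S : Finset A.hyperplanes) : Finset (AffineSubspace ℂ (Space ℓ)) :=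
  S.map (Function.Embedding.subtype _)

lemma mem_inter_hyps {S : Finset A.hyperplanes} {p : Space ℓ} :
    p ∈ inter (hyps S) ↔ ∀ H ∈ S, form A H p = level A H := by
  rw [mem_inter]
  simp only [hyps, Finset.mem_map, Function.Embedding.subtype_apply, ← mem_hyperplane]
  constructor
  · exact fun h H hH => h _ ⟨H, hH, rfl⟩
  · rintro h _ ⟨H, hH, rfl⟩
    exact h H hH

lemma inter_hyps_nonempty {S : Finset A.hyperplanes} :
    (inter (hyps S) : Set (Space ℓ)).Nonempty ↔ vecInf ℓ ∉ span ℂ (vec A '' S) := by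
  rw [vecInf_notMem_span_iff]
  exact exists_congr fun p => mem_inter_hyps

/-- The codimension of a nonempty intersection is the rank of the linear forms. At a common point
`p` the constants are the values `f p`, so the injection `f ↦ (f, f p)` identifies dependence of
forms and of full equations. -/
lemma isDependent_hyps_iff {S : Finset A.hyperplanes} :
    IsDependent (hyps S) ↔
      vecInf ℓ ∉ span ℂ (vec A '' S) ∧ ¬ LinearIndepOn ℂ (vec A) S := by
  rw [IsDependent, inter_hyps_nonempty]
  refine and_congr_right fun h => ?_
  obtain ⟨p, hp⟩ := vecInf_notMem_span_iff.1 h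
  have hdir : (inter (hyps S)).direction = (span ℂ (form A '' S)).dualCoannihilator := by
    ext u
    have hpS : p ∈ inter (hyps S) := mem_inter_hyps.2 hp
    rw [AffineSubspace.mem_direction_iff_eq_vsub_right hpS, mem_dualCoannihilator]
    constructor
    · rintro ⟨q, hq, rfl⟩ φ hφ
      refine span_induction (p := fun φ _ => φ (q -ᵥ p) = 0) ?_ ?_ ?_ ?_ hφ
      · rintro _ ⟨H, hH, rfl⟩
        rw [vsub_eq_sub, map_sub, hp H hH, mem_inter_hyps.1 hq H hH, sub_self]
      · simp
      · intro x y _ _ hx hy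
        rw [LinearMap.add_apply, hx, hy, add_zero]
      · intro a x _ hx
        rw [LinearMap.smul_apply, hx, smul_zero]
    · intro hu
      refine ⟨u + p, mem_inter_hyps.2 fun H hH => ?_, by simp⟩
      rw [map_add, hu _ (subset_span ⟨H, hH, rfl⟩), hp H hH, zero_add]
  have hfr := Subspace.finrank_add_finrank_dualCoannihilator_eq (span ℂ (form A '' S))
  rw [← hdir, finrank_fin_fun] at hfr
  have hcard : (hyps S).card = S.card := Finset.card_map _
  let g : Dual ℂ (Space ℓ) →ₗ[ℂ] Dual ℂ (Space ℓ) × ℂ :=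
    LinearMap.prod LinearMap.id (Dual.eval ℂ (Space ℓ) p)
  have hg : LinearMap.ker g = ⊥ := by
    rw [LinearMap.ker_eq_bot']
    intro f hf
    exact congrArg Prod.fst hf
  have hvec : LinearIndepOn ℂ (vec A) S ↔ LinearIndepOn ℂ (form A) S := by
    rw [LinearIndepOn, LinearIndepOn, ← LinearMap.linearIndependent_iff g hg]
    have : (fun H : (S : Set A.hyperplanes) => vec A H) =
        g ∘ fun H : (S : Set A.hyperplanes) => form A H := by
      funext H
      simp [g, vec, hp H.1 H.2]
    rw [this]
  have hle : Set.finrank ℂ (Set.range fun H : (S : Set A.hyperplanes) => form A H) ≤ S.card := by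
    refine (finrank_range_le_card _).trans ?_
    simp
  rw [hvec, LinearIndepOn, linearIndependent_iff_card_eq_finrank_span, hcard]
  rw [Set.finrank, ← Set.image_eq_range] at hle ⊢
  simp only [Finset.coe_sort_coe, Fintype.card_coe]
  have key : ∀ a b c : ℕ, a + b = ℓ → a ≤ c → (ℓ < c + b ↔ ¬ c = a) := by omega
  exact key _ _ _ hfr hle

lemma not_isDependent_hyps_empty : ¬ IsDependent (hyps (∅ : Finset A.hyperplanes)) := by
  rw [isDependent_hyps_iff]
  rintro ⟨-, h⟩
  apply h
  rw [Finset.coe_empty]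
  exact linearIndepOn_empty _ _

lemma hyps_mono {S T : Finset A.hyperplanes} : hyps S ⊆ hyps T ↔ S ⊆ T := Finset.map_subset_map

lemma exists_hyps_eq {S : Finset A.hyperplanes} {C : Finset (AffineSubspace ℂ (Space ℓ))}
    (h : C ⊆ hyps S) : ∃ C' ⊆ S, hyps C' = C := by
  classical
  refine ⟨S.filter fun H => H.1 ∈ C, Finset.filter_subset _ _, ?_⟩
  ext H
  simp only [hyps, Finset.mem_map, Finset.mem_filter, Function.Embedding.subtype_apply]
  constructor
  · rintro ⟨H, h, rfl⟩
    exact h.2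
  · intro hH
    obtain ⟨H', h', rfl⟩ := Finset.mem_map.1 (h hH)
    exact ⟨H', ⟨h', hH⟩, rfl⟩

end Forms

/-! ### Relations in the Orlik–Solomon ideal -/

section Generators

open Module Submodule

variable {K : Type*} [Field K] {ℓ : ℕ} {A : Arrangement ℓ}

lemma mono_eq_monom {t : ℕ} (s : Fin t → A.hyperplanes) :
    mono K A s = monom K (List.ofFn s) := by
  rw [mono, ExteriorAlgebra.ιMulti_apply, monom, List.map_ofFn]
  refine congrArg List.prod (congrArg List.ofFn (funext fun i => ?_))
  rw [Function.comp_apply, e, gen]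
  congr!

lemma contr_total_ofFn {ι : Type*} [Fintype ι] {t : ℕ} (s : Fin (t + 1) → ι) :
    contr (total K ι) (monom K (List.ofFn s)) =
      ∑ j : Fin (t + 1), (-1 : K) ^ (j : ℕ) • monom K (List.ofFn fun i => s (j.succAbove i)) := by
  induction t with
  | zero =>
    have := contr_gen_mul (total K ι) (s 0) 1
    simpa [contr_one] using this
  | succ t ih =>
    rw [List.ofFn_succ, monom_cons, contr_gen_mul, total_single, one_smul, ih, Fin.sum_univ_succ (n := t + 1),
      Finset.mul_sum, sub_eq_add_neg, ← Finset.sum_neg_distrib]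
    congr 1
    · simp
    · refine Finset.sum_congr rfl fun j _ => ?_
      rw [List.ofFn_succ (f := fun i => s (j.succ.succAbove i)), monom_cons]
      simp [pow_succ]

/-- The minus sign comes from counting positions from `1` in the boundary. -/
lemma boundary_eq_neg_contr {t : ℕ} (s : Fin (t + 1) → A.hyperplanes) :
    boundary K A s = - contr (total K A.hyperplanes) (monom K (List.ofFn s)) := by
  rw [boundary, contr_total_ofFn, ← Finset.sum_neg_distrib]
  refine Finset.sum_congr rfl fun j _ => ?_
  rw [mono_eq_monom, pow_succ, Algebra.smul_def]
  simp

lemma support_eq_hyps {t : ℕ} (s : Fin t ↪ A.hyperplanes) :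
    support s = hyps (Finset.univ.map s) := by
  rw [support, hyps, Finset.map_map]

lemma exists_embedding_of_nodup {L : List A.hyperplanes} (hL : L.Nodup) :
    ∃ s : Fin L.length ↪ A.hyperplanes, List.ofFn s = L ∧ ∀ S : Finset A.hyperplanes,
      (∀ H, H ∈ S ↔ H ∈ L) → support s = hyps S := by
  refine ⟨⟨L.get, List.nodup_iff_injective_get.1 hL⟩, List.ofFn_get L, fun S hS => ?_⟩
  rw [support_eq_hyps]
  congr 1
  ext H
  rw [hS, Finset.mem_map]
  simp [List.mem_iff_get]

variable (K A) in
/-- The generators of the Orlik-Solomon ideal, together with the hyperplanes in `Z`. -/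
def osGeneratorsAdd (Z : Set A.hyperplanes) : Set (ExteriorAlgebra K (A.hyperplanes → K)) :=
  gen K '' Z ∪ osGenerators K A

variable {Z : Set A.hyperplanes}

lemma osGeneratorsAdd_insert (H : A.hyperplanes) :
    osGeneratorsAdd K A (insert H Z) = insert (gen K H) (osGeneratorsAdd K A Z) := by
  rw [osGeneratorsAdd, Set.image_insert_eq, Set.insert_union, osGeneratorsAdd]

lemma osGeneratorsAdd_empty : osGeneratorsAdd K A ∅ = osGenerators K A := by
  rw [osGeneratorsAdd, Set.image_empty, Set.empty_union]

lemma monom_mem_of_vecInf_mem {L : List A.hyperplanes}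
    (h : vecInf ℓ ∈ span ℂ (vec A '' {H | H ∈ L})) :
    monom K L ∈ TwoSidedIdeal.span (osGeneratorsAdd K A Z) := by
  classical
  by_cases hL : L.Nodup
  swap
  · rw [monom_eq_zero hL]; exact TwoSidedIdeal.zero_mem _
  obtain ⟨s, hs, hsupp⟩ := exists_embedding_of_nodup hL
  refine TwoSidedIdeal.subset_span (Or.inr (Or.inr ⟨_, s, ?_, ?_⟩))
  · rw [hsupp L.toFinset (by simp), ← Set.not_nonempty_iff_eq_empty, inter_hyps_nonempty, not_not]
    simpa using h
  · rw [mono_eq_monom, hs]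

lemma contr_mem_of_minimal {C : Finset A.hyperplanes} (hC : Minimal IsDependent (hyps C)) :
    contr (total K A.hyperplanes) (monom K C.toList) ∈
      TwoSidedIdeal.span (osGeneratorsAdd K A Z) := by
  obtain ⟨s, hs, hsupp⟩ := exists_embedding_of_nodup C.nodup_toList
  obtain ⟨t, ht⟩ : ∃ t, C.toList.length = t + 1 := by
    refine Nat.exists_eq_succ_of_ne_zero fun h0 => ?_
    rw [Finset.length_toList, Finset.card_eq_zero] at h0
    exact not_isDependent_hyps_empty (h0 ▸ hC.1)
  have hsupp := hsupp C (by simp)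
  generalize C.toList = L at *
  generalize L.length = n at *
  subst ht
  have : -boundary K A s ∈ TwoSidedIdeal.span (osGeneratorsAdd K A Z) := by
    refine TwoSidedIdeal.neg_mem _ (TwoSidedIdeal.subset_span (Or.inr (Or.inl ⟨t, s, ?_, rfl⟩)))
    rwa [hsupp]
  rwa [boundary_eq_neg_contr, neg_neg, hs] at this

/-- A dependent set contains a circuit `C`. Both the monomial of `C` and its contraction lie in the
ideal, so the antiderivation rule handles the remaining factors. -/
lemma contr_monom_mem_of_dependent {L : List A.hyperplanes} (hL : L.Nodup)
    {S : Finset A.hyperplanes} (hS : ∀ H, H ∈ S ↔ H ∈ L) (h : IsDependent (hyps S)) :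
    contr (total K A.hyperplanes) (monom K L) ∈
      TwoSidedIdeal.span (osGeneratorsAdd K A Z) := by
  classical
  set I := TwoSidedIdeal.span (osGeneratorsAdd K A Z)
  obtain ⟨C, hC, hmin⟩ := exists_minimal_le_of_wellFoundedLT IsDependent _ h
  obtain ⟨C, hCL, rfl⟩ := exists_hyps_eq hC
  have h1 : contr (total K A.hyperplanes) (monom K C.toList) ∈ I := contr_mem_of_minimal hmin
  have h2 : monom K C.toList ∈ I := by
    have hne : C.toList ≠ [] := by
      rw [Ne, Finset.toList_eq_nil]
      rintro rfl
      exact not_isDependent_hyps_empty hmin.1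
    obtain ⟨c, M, hM⟩ := List.exists_cons_of_ne_nil hne
    rw [hM] at h1 ⊢
    -- Multiplying the circuit relation by one of its generators `e_c` recovers the whole monomial,
    -- all other terms containing `e_c` twice.
    have h3 := I.mul_mem_left (gen K c) _ h1
    rwa [monom_cons, contr_gen_mul, mul_sub, ← mul_assoc, gen_mul_self, zero_mul,
      sub_zero, total_single, one_smul] at h3
  have hperm : L.Perm (C.toList ++ L.filter (fun H => H ∉ C)) := by
    refine (List.filter_append_perm (fun H => decide (H ∈ C)) L).symm.trans ?_
    refine List.Perm.append ?_ (by simp)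
    rw [List.perm_ext_iff_of_nodup (hL.filter _) C.nodup_toList]
    intro H
    simp only [List.mem_filter, decide_eq_true_eq, Finset.mem_toList, and_iff_right_iff_imp]
    exact fun h => (hS H).1 (hCL h)
  have h3 : contr (total K A.hyperplanes) (monom K (C.toList ++ L.filter (fun H => H ∉ C))) ∈ I := by
    rw [monom_append, contr_monom_mul]
    exact I.add_mem (I.mul_mem_right _ _ h1)
      (TwoSidedIdeal.smul_mem' I _ (I.mul_mem_right _ _ h2))
  rcases monom_perm (K := K) hperm with h | h
  · rwa [h]
  · rw [h, map_neg]; exact I.neg_mem h3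

lemma contr_monom_cons_mem {H : A.hyperplanes} {T : List A.hyperplanes} (hT : T.Nodup)
    (hH : H ∉ T) (h : vec A H ∈ span ℂ (vec A '' {H | H ∈ T}))
    (h0 : vecInf ℓ ∉ span ℂ (vec A '' {H | H ∈ T})) :
    contr (total K A.hyperplanes) (monom K (H :: T)) ∈
      TwoSidedIdeal.span (osGeneratorsAdd K A Z) := by
  classical
  refine contr_monom_mem_of_dependent (S := (H :: T).toFinset) (List.nodup_cons.2 ⟨hH, hT⟩)
    (by simp) ?_
  rw [isDependent_hyps_iff]
  have hset : ((H :: T).toFinset : Set A.hyperplanes) =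
      insert H {H | H ∈ T} := by
    ext; simp
  rw [hset]
  constructor
  · rwa [Set.image_insert_eq, span_insert_eq_span h]
  · intro hli
    rw [linearIndepOn_insert (by simpa using hH)] at hli
    exact hli.2 h

/-- Once `e_z` is zero, the relation obtained by adjoining `z` to `L` reduces to the monomial of
`L`. -/
lemma monom_mem_of_vec_mem {z : A.hyperplanes} (hz : z ∈ Z) {L : List A.hyperplanes}
    (h : vec A z ∈ span ℂ (vec A '' {H | H ∈ L})) :
    monom K L ∈ TwoSidedIdeal.span (osGeneratorsAdd K A Z) := by
  set I := TwoSidedIdeal.span (osGeneratorsAdd K A Z) with hI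
  have hzI : gen K z ∈ I := TwoSidedIdeal.subset_span (Or.inl ⟨z, hz, rfl⟩)
  by_cases hL : L.Nodup
  swap
  · rw [monom_eq_zero hL]; exact I.zero_mem
  by_cases h0 : vecInf ℓ ∈ span ℂ (vec A '' {H | H ∈ L})
  · exact monom_mem_of_vecInf_mem h0
  by_cases hzL : z ∈ L
  · obtain ⟨L₁, L₂, rfl⟩ := List.append_of_mem hzL
    rw [monom_append, monom_cons]
    exact I.mul_mem_left _ _ (I.mul_mem_right _ _ hzI)
  · have h1 : contr (total K A.hyperplanes) (monom K (z :: L)) ∈ I :=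
      contr_monom_cons_mem hL hzL h h0
    rw [monom_cons, contr_gen_mul, total_single, one_smul] at h1
    have := I.add_mem h1 (I.mul_mem_right _ (contr (total K A.hyperplanes) (monom K L)) hzI)
    rwa [sub_add_cancel] at this

lemma onlyRelations [LinearOrder A.hyperplanes] {U : Submodule ℂ (Dual ℂ (Space ℓ) × ℂ)}
    (hU : ∀ z ∈ Z, vecInf ℓ ∈ sp (vec A) U {z}) :
    OnlyRelations (TwoSidedIdeal.span (osGeneratorsAdd K A Z)) (vec A) (vecInf ℓ) U := by
  intro ρ h1 h2 y hy
  have hle : TwoSidedIdeal.span (osGeneratorsAdd K A Z) ≤ TwoSidedIdeal.ker ρ := by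
    rw [TwoSidedIdeal.span_le]
    rintro _ (⟨z, hz, rfl⟩ | ⟨t, s, hs, rfl⟩ | ⟨t, s, hs, rfl⟩) <;>
      rw [SetLike.mem_coe, TwoSidedIdeal.mem_ker]
    · have := h1 [z] (by simpa using hU z hz)
      simpa using this
    · rw [boundary_eq_neg_contr, map_neg, neg_eq_zero]
      have hnd : (List.ofFn s).Nodup := List.nodup_ofFn.2 s.injective
      refine h2 _ hnd ?_
      have hf : (List.ofFn s).toFinset = Finset.univ.map s := by
        ext
        simp only [List.mem_toFinset, List.mem_ofFn, Finset.mem_map, Finset.mem_univ, true_and]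
      rw [support_eq_hyps, ← hf] at hs
      have := (isDependent_hyps_iff.1 hs.1).2
      rw [linearIndepOn_finset_iff] at this
      push Not at this
      obtain ⟨a, ha, i, hi, hai⟩ := this
      exact ⟨a, ⟨i, hi, hai⟩, by rw [ha]; exact zero_mem _⟩
    · rw [mono_eq_monom]
      refine h1 _ ?_
      rw [support_eq_hyps, ← Set.not_nonempty_iff_eq_empty, inter_hyps_nonempty, not_not] at hs
      refine mem_sup_right ?_
      have hset : {H | H ∈ List.ofFn s} = (Finset.univ.map s : Finset A.hyperplanes) := by
        ext; simp [List.mem_ofFn]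
      rwa [hset]
  exact (TwoSidedIdeal.mem_ker _).1 (hle hy)

end Generators

end OSArr

end

noncomputable section

namespace OSArr

/-! ### Contractions by central blocks -/

section Summands

open Module Submodule

variable {K : Type*} [Field K] {ℓ : ℕ} {A : Arrangement ℓ}

lemma contr_comm {ι : Type*} (θ θ' : Module.Dual K (ι → K)) (y : ExteriorAlgebra K (ι → K)) :
    contr θ (contr θ' y) = - contr θ' (contr θ y) :=
  CliffordAlgebra.contractLeft_comm _ _ _

open Classical in
lemma contr_monom_congr {ι : Type*} {θ θ' : Module.Dual K (ι → K)} {L : List ι}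
    (h : ∀ i ∈ L, θ (Pi.single i 1) = θ' (Pi.single i 1)) :
    contr θ (monom K L) = contr θ' (monom K L) := by
  induction L with
  | nil => simp [contr_one]
  | cons i L ih =>
    rw [monom_cons, contr_gen_mul, contr_gen_mul, h i (by simp),
      ih fun j hj => h j (List.mem_cons_of_mem _ hj)]

/-- The sum of the coordinates in `B`, as a linear form. -/
def blockForm (K : Type*) [Field K] {ι : Type*} (B : Finset ι) : Module.Dual K (ι → K) :=
  ∑ i ∈ B, LinearMap.proj i

lemma blockForm_apply {ι : Type*} (B : Finset ι) (x : ι → K) :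
    blockForm K B x = ∑ i ∈ B, x i := by
  simp [blockForm, LinearMap.sum_apply]

open Classical in
lemma blockForm_single {ι : Type*} (B : Finset ι) (i : ι) :
    blockForm K B (Pi.single i 1) = if i ∈ B then 1 else 0 := by
  rw [blockForm_apply]
  simp [Pi.single_apply]

/-- The map `π` is the projection onto the span of the equations of the hyperplanes in `B` along
the span of the other equations and of the equation of the hyperplane at infinity. -/
structure IsBlockProj (B : Finset A.hyperplanes)
    (π : (Dual ℂ (Space ℓ) × ℂ) →ₗ[ℂ] (Dual ℂ (Space ℓ) × ℂ)) : Prop where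
  of_mem : ∀ H ∈ B, π (vec A H) = vec A H
  of_notMem : ∀ H ∉ B, π (vec A H) = 0
  inf : π (vecInf ℓ) = 0

variable {B : Finset A.hyperplanes} {π : (Dual ℂ (Space ℓ) × ℂ) →ₗ[ℂ] (Dual ℂ (Space ℓ) × ℂ)}

lemma IsBlockProj.apply_mem_span (hπ : IsBlockProj B π) {X : Set A.hyperplanes}
    {w : Dual ℂ (Space ℓ) × ℂ} (hw : w ∈ span ℂ (vec A '' X)) : π w ∈ span ℂ (vec A '' X) := by
  refine span_induction (p := fun w _ => π w ∈ span ℂ (vec A '' X)) ?_ ?_ ?_ ?_ hw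
  · rintro _ ⟨H, hH, rfl⟩
    by_cases h : H ∈ B
    · rw [hπ.of_mem H h]; exact subset_span ⟨H, hH, rfl⟩
    · rw [hπ.of_notMem H h]; exact zero_mem _
  · simp
  · intro x y _ _ hx hy
    rw [map_add]; exact add_mem hx hy
  · intro a x _ hx
    rw [map_smul]; exact smul_mem _ _ hx

lemma IsBlockProj.sub_apply_mem_span (hπ : IsBlockProj B π) {X : Set A.hyperplanes}
    {w : Dual ℂ (Space ℓ) × ℂ} (hw : w ∈ span ℂ (vec A '' X)) :
    w - π w ∈ span ℂ (vec A '' {H | H ∈ X ∧ H ∉ B}) := by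
  refine span_induction
    (p := fun w _ => w - π w ∈ span ℂ (vec A '' {H | H ∈ X ∧ H ∉ B})) ?_ ?_ ?_ ?_ hw
  · rintro _ ⟨H, hH, rfl⟩
    by_cases h : H ∈ B
    · rw [hπ.of_mem H h, sub_self]; exact zero_mem _
    · rw [hπ.of_notMem H h, sub_zero]; exact subset_span ⟨H, ⟨hH, h⟩, rfl⟩
  · simp
  · intro x y _ _ hx hy
    rw [map_add, add_sub_add_comm]; exact add_mem hx hy
  · intro a x _ hx
    rw [map_smul, ← smul_sub]; exact smul_mem _ _ hx

/-- The projection cuts a linear relation on a circuit into its parts inside and outside the block.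
The part with a nonzero coefficient is already dependent, so by minimality it is the whole circuit.
-/
lemma IsBlockProj.subset_or_disjoint (hπ : IsBlockProj B π) {C : Finset A.hyperplanes}
    (hC : Minimal IsDependent (hyps C)) : (∀ H ∈ C, H ∈ B) ∨ ∀ H ∈ C, H ∉ B := by
  classical
  obtain ⟨h0, hdep⟩ := isDependent_hyps_iff.1 hC.1
  rw [linearIndepOn_finset_iff] at hdep
  push Not at hdep
  obtain ⟨a, ha, i, hi, hai⟩ := hdep
  have hP : ∑ H ∈ C.filter (· ∈ B), a H • vec A H = 0 := by
    have := congrArg π ha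
    rw [map_sum, map_zero, ← Finset.sum_filter_add_sum_filter_not C (· ∈ B),
      Finset.sum_eq_zero (s := C.filter (· ∉ B)), add_zero] at this
    · rw [← this]
      refine Finset.sum_congr rfl fun H hH => ?_
      rw [map_smul, hπ.of_mem H (Finset.mem_filter.1 hH).2]
    · intro H hH
      rw [map_smul, hπ.of_notMem H (Finset.mem_filter.1 hH).2, smul_zero]
  have hQ : ∑ H ∈ C.filter (· ∉ B), a H • vec A H = 0 := by
    rw [← Finset.sum_filter_add_sum_filter_not C (· ∈ B), hP, zero_add] at ha
    exact ha
  have key : ∀ P ⊆ C, ∑ H ∈ P, a H • vec A H = 0 → i ∈ P → C ⊆ P := by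
    intro P hPC hP hiP
    refine hyps_mono.1 (hC.2 (isDependent_hyps_iff.2 ⟨fun h => h0 ?_, fun h => hai ?_⟩)
      (hyps_mono.2 hPC))
    · exact span_mono (Set.image_mono (by exact_mod_cast hPC)) h
    · exact linearIndepOn_finset_iff.1 h a hP i hiP
  by_cases hiB : i ∈ B
  · left
    have := key _ (Finset.filter_subset _ _) hP (Finset.mem_filter.2 ⟨hi, hiB⟩)
    exact fun H hH => (Finset.mem_filter.1 (this hH)).2
  · right
    have := key _ (Finset.filter_subset _ _) hQ (Finset.mem_filter.2 ⟨hi, hiB⟩)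
    exact fun H hH => (Finset.mem_filter.1 (this hH)).2

/-- On a circuit inside the block the form agrees with `total`, so contracting twice gives zero; on
a circuit outside it vanishes. The monomials with empty intersection stay in the ideal because the
factors outside the block are already inconsistent. -/
lemma IsBlockProj.contr_mem (hπ : IsBlockProj B π) {Z : Set A.hyperplanes}
    (hZ : ∀ z ∈ Z, z ∉ B) {y : ExteriorAlgebra K (A.hyperplanes → K)}
    (hy : y ∈ TwoSidedIdeal.span (osGeneratorsAdd K A Z)) :
    contr (blockForm K B) y ∈ TwoSidedIdeal.span (osGeneratorsAdd K A Z) := by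
  classical
  set I := TwoSidedIdeal.span (osGeneratorsAdd K A Z) with hI
  have hsign : ∀ g : ExteriorAlgebra K (A.hyperplanes → K), g ∈ I →
      (gradeInv K A.hyperplanes g = g ∨ gradeInv K A.hyperplanes g = -g) →
      gradeInv K A.hyperplanes g ∈ I := by
    rintro g hg (h | h) <;> rw [h]
    exacts [hg, I.neg_mem hg]
  refine contr_mem_span ?_ ?_ hy
  · intro g hg
    refine hsign g (TwoSidedIdeal.subset_span hg) ?_
    rcases hg with ⟨z, hz, rfl⟩ | ⟨t, s, hs, rfl⟩ | ⟨t, s, hs, rfl⟩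
    · exact Or.inr (gradeInv_ι _)
    · rw [boundary_eq_neg_contr, map_neg, gradeInv_contr]
      rcases gradeInv_monom (K := K) (List.ofFn s) with h | h <;> rw [h] <;> simp
    · rw [mono_eq_monom]
      exact gradeInv_monom _
  · rintro g (⟨z, hz, rfl⟩ | ⟨t, s, hs, rfl⟩ | ⟨t, s, hs, rfl⟩)
    · have := contr_gen_mul (blockForm K B) z 1
      rw [mul_one, blockForm_single, if_neg (hZ z hz), contr_one] at this
      rw [this]
      simp
    · rw [boundary_eq_neg_contr, map_neg, contr_comm, neg_neg]
      rw [support_eq_hyps] at hs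
      have hmem : ∀ H ∈ List.ofFn s, H ∈ Finset.univ.map s := by
        intro H hH
        obtain ⟨i, rfl⟩ := List.mem_ofFn.1 hH
        simp
      have hz : contr (total K A.hyperplanes) (contr (blockForm K B) (monom K (List.ofFn s))) =
          0 := by
        rcases hπ.subset_or_disjoint hs with h | h
        · rw [contr_monom_congr (θ' := total K A.hyperplanes), contr_contr]
          intro H hH
          rw [blockForm_single, if_pos (h H (hmem H hH)), total_single]
        · rw [contr_monom_congr (θ' := 0)]
          · simp [contr]
          · intro H hH
            rw [blockForm_single, if_neg (h H (hmem H hH)), LinearMap.zero_apply]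
      rw [hz]
      exact I.zero_mem
    · rw [mono_eq_monom]
      rw [support_eq_hyps, ← Set.not_nonempty_iff_eq_empty, inter_hyps_nonempty, not_not] at hs
      -- The projection kills `vecInf ℓ`, so the equations outside `B` alone span it; deleting a
      -- factor in `B` keeps the intersection empty.
      have h1 := hπ.sub_apply_mem_span hs
      rw [hπ.inf, sub_zero] at h1
      suffices h : contr (blockForm K B) (monom K (List.ofFn s)) ∈ idealSubmodule (K := K) I from h
      refine span_le.2 ?_ (contr_monom_mem (K := K) (blockForm K B) (List.ofFn s))
      rintro _ ⟨c, M, hp, hc, rfl⟩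
      have hcB : c ∈ B := by
        by_contra h
        exact hc (by rw [blockForm_single, if_neg h])
      refine monom_mem_of_vecInf_mem (span_mono (Set.image_mono ?_) h1)
      rintro H ⟨hH, hHB⟩
      have : H ∈ List.ofFn s := by
        obtain ⟨i, -, rfl⟩ := Finset.mem_map.1 (Finset.mem_coe.1 hH)
        exact List.mem_ofFn.2 ⟨i, rfl⟩
      rcases List.mem_cons.1 (hp.mem_iff.1 this) with rfl | h
      · exact absurd hcB hHB
      · exact h

/-! ### Gluing the central blocks to the hyperplane at infinity -/

/-- Disjoint blocks that split off as direct summands, with a hyperplane chosen in each of them. -/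
structure BlockSystem (A : Arrangement ℓ) (κ : Type*) where
  block : κ → Finset A.hyperplanes
  proj : κ → ((Dual ℂ (Space ℓ) × ℂ) →ₗ[ℂ] (Dual ℂ (Space ℓ) × ℂ))
  isBlockProj : ∀ a, IsBlockProj (block a) (proj a)
  base : κ → A.hyperplanes
  base_mem : ∀ a, base a ∈ block a
  disjoint : ∀ a b H, H ∈ block a → H ∈ block b → a = b

namespace BlockSystem

variable {κ : Type*} (S : BlockSystem A κ)

/-- Modulo this subspace the chosen hyperplanes coincide with the hyperplane at infinity. -/
def gluing : Submodule ℂ (Dual ℂ (Space ℓ) × ℂ) :=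
  span ℂ (Set.range fun a => vec A (S.base a) - vecInf ℓ)

variable {S}

lemma vecInf_mem_sp_base (a : κ) : vecInf ℓ ∈ sp (vec A) S.gluing {S.base a} := by
  have h1 : vec A (S.base a) - vecInf ℓ ∈ sp (vec A) S.gluing {S.base a} :=
    le_sp _ _ _ (subset_span ⟨a, rfl⟩)
  have h2 := sub_mem (mem_sp (vec A) (U := S.gluing) (Set.mem_singleton (S.base a))) h1
  rwa [sub_sub_cancel] at h2

variable [Fintype κ]

lemma exists_of_mem_gluing {u : Dual ℂ (Space ℓ) × ℂ} (hu : u ∈ S.gluing) :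
    ∃ c : κ → ℂ, u = ∑ a, c a • (vec A (S.base a) - vecInf ℓ) ∧
      ∀ a, S.proj a u = c a • vec A (S.base a) := by
  classical
  obtain ⟨c, rfl⟩ := (mem_span_range_iff_exists_fun ℂ).1 hu
  refine ⟨c, rfl, fun a => ?_⟩
  rw [map_sum, Finset.sum_eq_single a]
  · rw [map_smul, map_sub, (S.isBlockProj a).inf, sub_zero,
      (S.isBlockProj a).of_mem _ (S.base_mem a)]
  · intro b _ hb
    rw [map_smul, map_sub, (S.isBlockProj a).inf, sub_zero,
      (S.isBlockProj a).of_notMem, smul_zero]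
    exact fun h => hb (S.disjoint _ _ _ (S.base_mem b) h)
  · simp

/-- Gluing creates no new span memberships as long as neither `vecInf ℓ` nor a chosen vector lies in
the span of `X`. Projecting to block `a` would otherwise express, from a nonzero coefficient `c a`,
the chosen vector (if the projection of `w` is zero) or `vecInf ℓ` (if `w` belongs to that block) in
terms of `X`. -/
lemma mem_span_of_mem_sp {w : Dual ℂ (Space ℓ) × ℂ} (hw : w = vecInf ℓ ∨ ∃ H, w = vec A H)
    {X : Set A.hyperplanes} (h : w ∈ sp (vec A) S.gluing X)
    (h0 : vecInf ℓ ∉ span ℂ (vec A '' X)) (hz : ∀ a, vec A (S.base a) ∉ span ℂ (vec A '' X)) :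
    w ∈ span ℂ (vec A '' X) := by
  classical
  obtain ⟨u, hu, s, hs, rfl⟩ := mem_sup.1 h
  obtain ⟨c, hc, hπ⟩ := exists_of_mem_gluing hu
  have hzero : ∀ a, S.proj a (u + s) = 0 → c a = 0 := by
    intro a ha
    by_contra hca
    rw [map_add, hπ] at ha
    refine hz a ((smul_mem_iff _ hca).1 ?_)
    rw [eq_neg_of_add_eq_zero_left ha]
    exact neg_mem ((S.isBlockProj a).apply_mem_span hs)
  suffices hc0 : ∀ a, c a = 0 by
    rw [hc]
    simpa [hc0] using hs
  rcases hw with hw | ⟨H, hw⟩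
  · exact fun a => hzero a (by rw [hw, (S.isBlockProj a).inf])
  · intro a
    by_cases hHa : H ∈ S.block a
    swap
    · exact hzero a (by rw [hw, (S.isBlockProj a).of_notMem H hHa])
    have hu' : u = c a • (vec A (S.base a) - vecInf ℓ) := by
      rw [hc, Finset.sum_eq_single a]
      · intro b _ hb
        rw [hzero b, zero_smul]
        rw [hw, (S.isBlockProj b).of_notMem]
        exact fun h => hb (S.disjoint _ _ _ h hHa)
      · simp
    have h1 : S.proj a (u + s) = u + s := by rw [hw, (S.isBlockProj a).of_mem H hHa]
    by_contra hca
    refine h0 ((smul_mem_iff _ hca).1 ?_)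
    have h2 : c a • vecInf ℓ = s - S.proj a s := by
      rw [map_add, hπ] at h1
      rw [hu', smul_sub] at h1
      have h3 := sub_eq_zero.2 h1
      rw [← sub_eq_zero, ← h3]
      abel
    rw [h2]
    exact sub_mem hs ((S.isBlockProj a).apply_mem_span hs)

/-- When `vecInf ℓ` or a chosen vector lies in a span, the monomial is already in the ideal;
otherwise spans modulo the gluing agree with honest spans and the original relations suffice. -/
lemma hasRelations :
    HasRelations (TwoSidedIdeal.span (osGeneratorsAdd K A (Set.range S.base))) (vec A) (vecInf ℓ)
      S.gluing := by
  have key : ∀ L : List A.hyperplanes, (vecInf ℓ ∈ span ℂ (vec A '' {H | H ∈ L}) ∨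
      ∃ a, vec A (S.base a) ∈ span ℂ (vec A '' {H | H ∈ L})) →
      monom K L ∈ TwoSidedIdeal.span (osGeneratorsAdd K A (Set.range S.base)) := by
    rintro L (h | ⟨a, h⟩)
    · exact monom_mem_of_vecInf_mem h
    · exact monom_mem_of_vec_mem (Set.mem_range_self a) h
  refine ⟨fun L hL => key L ?_, fun H T hT hHT h => ?_⟩
  · by_contra hcon
    push Not at hcon
    exact hcon.1 (mem_span_of_mem_sp (Or.inl rfl) hL hcon.1 hcon.2)
  · by_cases hcon : vecInf ℓ ∈ span ℂ (vec A '' {H | H ∈ T}) ∨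
      ∃ a, vec A (S.base a) ∈ span ℂ (vec A '' {H | H ∈ T})
    · exact Or.inl (key T hcon)
    · push Not at hcon
      exact Or.inr (contr_monom_cons_mem hT hHT
        (mem_span_of_mem_sp (Or.inr ⟨H, rfl⟩) h hcon.1 hcon.2) hcon.1)

lemma vecInf_notMem_gluing : vecInf ℓ ∉ S.gluing := by
  intro h
  obtain ⟨c, hc, hπ⟩ := exists_of_mem_gluing h
  apply vecInf_ne_zero (ℓ := ℓ)
  rw [hc]
  refine Finset.sum_eq_zero fun a _ => ?_
  have := hπ a
  rw [(S.isBlockProj a).inf] at this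
  rw [(smul_eq_zero.1 this.symm).resolve_right (vec_ne_zero A _), zero_smul]

/-- Exactness on the Orlik-Solomon algebra passes to its quotient by the chosen hyperplanes. -/
lemma exactOn_of_forall_sum_eq_zero {x : A.hyperplanes → K}
    (h : ExactOn (TwoSidedIdeal.span (osGenerators K A)) x)
    (hx : ∀ a, ∑ H ∈ S.block a, x H = 0) :
    ExactOn (TwoSidedIdeal.span (osGeneratorsAdd K A (Set.range S.base))) x := by
  classical
  have : ∀ T : Finset κ, ExactOn (TwoSidedIdeal.span (osGeneratorsAdd K A (S.base '' T))) x := by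
    intro T
    induction T using Finset.induction_on with
    | empty => simpa [osGeneratorsAdd_empty] using h
    | insert a T ha ih =>
      rw [Finset.coe_insert, Set.image_insert_eq, osGeneratorsAdd_insert, gen]
      refine ih.span_insert (θ := blockForm K (S.block a)) ?_ ?_ ?_
      · intro y hy
        refine (S.isBlockProj a).contr_mem ?_ hy
        rintro _ ⟨b, hb, rfl⟩ hba
        exact ha (S.disjoint _ _ _ (S.base_mem b) hba ▸ hb)
      · rw [blockForm_apply, hx]
      · rw [blockForm_single, if_pos (S.base_mem a)]
  simpa using this Finset.univ

/-- If the configuration of all hyperplanes is connected modulo the gluing, then no element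
satisfying the sum conditions acts exactly. -/
theorem not_exactOn (hconn : ∀ Q : Set A.hyperplanes, Q.Nonempty →
      ¬ sp (vec A) S.gluing Q ⊓ sp (vec A) (S.gluing ⊔ span ℂ {vecInf ℓ}) Qᶜ ≤ S.gluing)
    {x : A.hyperplanes → K} (hx : ∀ a, ∑ H ∈ S.block a, x H = 0) :
    ¬ ExactOn (TwoSidedIdeal.span (osGenerators K A)) x := by
  intro h
  let _ : LinearOrder A.hyperplanes :=
    LinearOrder.lift' (Fintype.equivFin A.hyperplanes) (Equiv.injective _)
  refine (conn_univ vecInf_notMem_gluing hconn).nbcSum_ne_zero (nbcSum_eq_zero (K := K)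
    S.hasRelations (onlyRelations ?_) (exactOn_of_forall_sum_eq_zero h hx))
  rintro _ ⟨a, rfl⟩
  exact vecInf_mem_sp_base a

end BlockSystem

end Summands

end OSArr

end

noncomputable section

namespace OSArr

/-! ### Irreducible factors and connectedness -/

section Irreducible

open Module Submodule

/-- The hyperplanes of an arrangement that are pulled back along `T`, for a map `T` with a
section `s`, form an arrangement in the target of `T`. -/
lemma Arrangement.exists_slice {n k : ℕ} (B : Arrangement n) (T : Space n →ₗ[ℂ] Space k)
    (s : Space k →ₗ[ℂ] Space n) :
    ∃ C : Arrangement k, ∀ H : AffineSubspace ℂ (Space n),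
      (H ∈ B.hyperplanes ∧ ∀ v, v ∈ H ↔ s (T v) ∈ H) ↔
        ∃ H' ∈ C.hyperplanes, H = H'.comap T.toAffineMap := by
  classical
  refine ⟨⟨(B.hyperplanes.filter fun H => ∀ v, v ∈ H ↔ s (T v) ∈ H).image
    fun H => H.comap s.toAffineMap, ?_⟩, fun H => ?_⟩
  · intro H' hH'
    obtain ⟨H, hH, rfl⟩ := Finset.mem_image.1 hH'
    obtain ⟨hB, hT⟩ := Finset.mem_filter.1 hH
    obtain ⟨f, c, hf, hfc⟩ := B.isAffineHyperplane H hB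
    refine ⟨f ∘ₗ s, c, fun h0 => hf ?_, fun v => by
      rw [AffineSubspace.mem_comap, hfc]; rfl⟩
    -- If `f ∘ₗ s` were zero, membership in `H` would not depend on `v`, whereas a nonzero form
    -- takes both values `c` and `c + 1`.
    have hs : ∀ v, f v = c ↔ (0 : ℂ) = c := by
      intro v
      rw [← hfc, hT, hfc, ← LinearMap.comp_apply, h0, LinearMap.zero_apply]
    by_contra hne
    obtain ⟨v, hv⟩ := LinearMap.surjective hne c
    obtain ⟨w, hw⟩ := LinearMap.surjective hne (c + 1)
    have := (hs w).2 ((hs v).1 hv)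
    rw [hw] at this
    simp at this
  · have key : ∀ H : AffineSubspace ℂ (Space n), (∀ v, v ∈ H ↔ s (T v) ∈ H) →
        H = (H.comap s.toAffineMap).comap T.toAffineMap := by
      intro H hH
      ext v
      exact hH v
    constructor
    · rintro ⟨hB, hT⟩
      exact ⟨_, Finset.mem_image.2 ⟨H, Finset.mem_filter.2 ⟨hB, hT⟩, rfl⟩, key H hT⟩
    · rintro ⟨H', hH', rfl⟩
      obtain ⟨H, hH, rfl⟩ := Finset.mem_image.1 hH'
      obtain ⟨hB, hT⟩ := Finset.mem_filter.1 hH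
      rw [← key H hT]
      exact ⟨hB, hT⟩

/-- An irreducible arrangement does not split along a pair of complementary subspaces. -/
lemma Arrangement.IsIrreducible.eq_bot_or_eq_bot {n : ℕ} {B : Arrangement n}
    (hB : B.IsIrreducible) {M N : Submodule ℂ (Space n)} (hMN : IsCompl M N)
    (h : ∀ H ∈ B.hyperplanes, (∀ v, ∀ u ∈ M, v + u ∈ H ↔ v ∈ H) ∨
      ∀ v, ∀ u ∈ N, v + u ∈ H ↔ v ∈ H) : M = ⊥ ∨ N = ⊥ := by
  let φ : Space n ≃ₗ[ℂ] Space (finrank ℂ M) × Space (finrank ℂ N) :=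
    (prodEquivOfIsCompl M N hMN).symm.trans
      ((Module.finBasis ℂ M).equivFun.prodCongr (Module.finBasis ℂ N).equivFun)
  have hφM : ∀ x, φ.symm (x, 0) ∈ M := by
    intro x
    simpa [φ] using sum_mem fun i _ => smul_mem M _ (SetLike.coe_mem _)
  have hφN : ∀ y, φ.symm (0, y) ∈ N := by
    intro y
    simpa [φ] using sum_mem fun i _ => smul_mem N _ (SetLike.coe_mem _)
  have hsum : ∀ v, v = φ.symm ((φ v).1, 0) + φ.symm (0, (φ v).2) := by
    intro v
    rw [← map_add, Prod.mk_add_mk, add_zero, zero_add, Prod.mk.eta, φ.symm_apply_apply]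
  obtain ⟨B₁, h₁⟩ := B.exists_slice (LinearMap.fst ℂ _ _ ∘ₗ φ.toLinearMap)
    (φ.symm.toLinearMap ∘ₗ LinearMap.inl ℂ _ _)
  obtain ⟨B₂, h₂⟩ := B.exists_slice (LinearMap.snd ℂ _ _ ∘ₗ φ.toLinearMap)
    (φ.symm.toLinearMap ∘ₗ LinearMap.inr ℂ _ _)
  have hprod : B.IsProduct B₁ B₂ := by
    refine ⟨φ.toAffineEquiv, fun H => ⟨fun hH => ?_, ?_⟩⟩
    · rcases h H hH with hM | hN
      -- Invariance under `M` means that only the coordinates along `N` matter.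
      · right
        refine (h₂ H).1 ⟨hH, fun v => ?_⟩
        conv_lhs => rw [hsum v, add_comm, hM _ _ (hφM _)]
        rfl
      · left
        refine (h₁ H).1 ⟨hH, fun v => ?_⟩
        conv_lhs => rw [hsum v, hN _ _ (hφN _)]
        rfl
    · rintro (h | h)
      exacts [((h₁ H).2 h).1, ((h₂ H).2 h).1]
  rcases hB.2 _ _ B₁ B₂ hprod with h | h
  · exact Or.inl (Submodule.finrank_eq_zero.1 h)
  · exact Or.inr (Submodule.finrank_eq_zero.1 h)

variable {ℓ : ℕ} {A : Arrangement ℓ}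

lemma exists_form_eq_level (H : A.hyperplanes) : ∃ p, form A H p = level A H :=
  LinearMap.surjective (form_ne_zero A H) _

/-- Translation by `u` preserves every hyperplane, hence also an intersection that is a single
point. -/
lemma eq_zero_of_form_eq_zero (hA : A.IsEssential) {u : Space ℓ}
    (hu : ∀ H, form A H u = 0) : u = 0 := by
  obtain ⟨S, hS, p, hp⟩ := hA
  have hmem : p ∈ inter S := by
    rw [← SetLike.mem_coe, hp]; rfl
  have : p + u ∈ inter S := by
    rw [mem_inter] at hmem ⊢
    intro H hH
    have h1 := (mem_hyperplane A ⟨H, hS hH⟩ p).1 (hmem H hH)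
    refine (mem_hyperplane A ⟨H, hS hH⟩ _).2 ?_
    rw [map_add, hu, add_zero, h1]
  rw [← SetLike.mem_coe, hp, Set.mem_singleton_iff] at this
  simpa using this

namespace IrreducibleDecomposition

variable (D : IrreducibleDecomposition A)

/-- The linear projection to the space of a factor. -/
def toFactor (j : Fin D.r) : Space ℓ →ₗ[ℂ] Space (D.dim j) :=
  LinearMap.proj j ∘ₗ D.coord.linear.toLinearMap

/-- The linear inclusion of the space of a factor. -/
def ofFactor (j : Fin D.r) : Space (D.dim j) →ₗ[ℂ] Space ℓ :=
  D.coord.linear.symm.toLinearMap ∘ₗ LinearMap.single ℂ (fun i => Space (D.dim i)) j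

/-- The points of the space of a factor, with the other coordinates equal to zero. -/
def point (j : Fin D.r) (x : Space (D.dim j)) : Space ℓ := D.coord.symm (Pi.single j x)

variable {D} {i j : Fin D.r} {H : A.hyperplanes}

@[simp] lemma toFactor_ofFactor (u : Space (D.dim j)) : D.toFactor j (D.ofFactor j u) = u := by
  simp [toFactor, ofFactor]

lemma toFactor_ofFactor_of_ne (h : i ≠ j) (u : Space (D.dim j)) :
    D.toFactor i (D.ofFactor j u) = 0 := by
  simp [toFactor, ofFactor, h]

lemma coord_add (p u : Space ℓ) : D.coord (p + u) j = D.coord p j + D.toFactor j u := by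
  have := D.coord.map_vadd p u
  rw [vadd_eq_add, vadd_eq_add, add_comm] at this
  rw [this, Pi.add_apply, add_comm]
  rfl

lemma coord_point (x : Space (D.dim j)) : D.coord (D.point j x) j = x := by
  simp [point]

lemma mem_block : H ∈ D.block j ↔ ∃ H' ∈ (D.factor j).hyperplanes,
    ∀ p, form A H p = level A H ↔ D.coord p j ∈ H' := by
  classical
  simp only [block, Finset.mem_filter, Finset.mem_univ, true_and]
  refine exists_congr fun H' => and_congr_right fun _ => ?_
  simp only [← mem_hyperplane]
  exact SetLike.ext_iff

lemma exists_mem_block (H : A.hyperplanes) : ∃ j, H ∈ D.block j := by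
  obtain ⟨j, h⟩ := (D.mem_iff H.1).1 H.2
  exact ⟨j, by classical simpa [block] using h⟩

lemma exists_of_mem_factor {H' : AffineSubspace ℂ (Space (D.dim j))}
    (hH' : H' ∈ (D.factor j).hyperplanes) :
    ∃ H ∈ D.block j, ∀ p, form A H p = level A H ↔ D.coord p j ∈ H' := by
  have hmem := (D.mem_iff _).2 ⟨j, H', hH', rfl⟩
  have key : ∀ p, form A ⟨_, hmem⟩ p = level A ⟨_, hmem⟩ ↔ D.coord p j ∈ H' := by
    intro p
    rw [← mem_hyperplane]
    rfl
  exact ⟨⟨_, hmem⟩, mem_block.2 ⟨H', hH', key⟩, key⟩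

lemma form_eq_zero (hH : H ∈ D.block j) {u : Space ℓ} (hu : D.toFactor j u = 0) :
    form A H u = 0 := by
  obtain ⟨H', -, h⟩ := mem_block.1 hH
  obtain ⟨p, hp⟩ := exists_form_eq_level H
  have : form A H (p + u) = level A H := by
    rw [h, coord_add, hu, add_zero, ← h, hp]
  rw [map_add, hp] at this
  simpa using this

lemma form_ofFactor_toFactor (hH : H ∈ D.block j) (u : Space ℓ) :
    form A H (D.ofFactor j (D.toFactor j u)) = form A H u := by
  rw [← sub_eq_zero, ← map_sub]
  exact form_eq_zero hH (by simp)

lemma form_ofFactor_of_ne (hH : H ∈ D.block i) (hij : i ≠ j) (u : Space (D.dim j)) :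
    form A H (D.ofFactor j u) = 0 :=
  form_eq_zero hH (toFactor_ofFactor_of_ne hij u)

lemma block_disjoint (hi : H ∈ D.block i) (hj : H ∈ D.block j) : i = j := by
  by_contra hij
  refine form_ne_zero A H (LinearMap.ext fun u => ?_)
  rw [← form_ofFactor_toFactor hj, form_ofFactor_of_ne hi hij, LinearMap.zero_apply]

lemma eq_zero_of_form_ofFactor_eq_zero (hA : A.IsEssential) {u : Space (D.dim j)}
    (hu : ∀ H ∈ D.block j, form A H (D.ofFactor j u) = 0) : u = 0 := by
  have : D.ofFactor j u = 0 := by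
    refine eq_zero_of_form_eq_zero hA fun H => ?_
    obtain ⟨i, hi⟩ := D.exists_mem_block H
    by_cases hij : i = j
    · subst hij; exact hu H hi
    · exact form_ofFactor_of_ne hi hij u
  rw [← toFactor_ofFactor u, this, map_zero]

lemma block_nonempty (hA : A.IsEssential) (j : Fin D.r) : (D.block j).Nonempty := by
  rw [Finset.nonempty_iff_ne_empty]
  intro h
  have h1 : (fun _ => 1 : Space (D.dim j)) = 0 :=
    eq_zero_of_form_ofFactor_eq_zero hA (by simp [h])
  exact one_ne_zero (congrFun h1 ⟨0, (D.irreducible j).1⟩)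

lemma isCentral_iff : (D.factor j).IsCentral ↔ ∃ p, ∀ H ∈ D.block j, form A H p = level A H := by
  constructor
  · rintro ⟨x, hx⟩
    refine ⟨D.point j x, fun H hH => ?_⟩
    obtain ⟨H', hH', h⟩ := mem_block.1 hH
    rw [h, coord_point]
    exact mem_inter.1 hx H' hH'
  · rintro ⟨p, hp⟩
    refine ⟨D.coord p j, mem_inter.2 fun H' hH' => ?_⟩
    obtain ⟨H, hH, h⟩ := exists_of_mem_factor hH'
    exact (h p).1 (hp H hH)

/-- With `τ` the projection of the space onto the factor and `p` a common point of the block, the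
map is `(f, c) ↦ (f ∘ τ, f (τ p))`. Centrality is what makes it reproduce the constants in the
block. -/
lemma exists_isBlockProj (hj : (D.factor j).IsCentral) : ∃ π, IsBlockProj (D.block j) π := by
  obtain ⟨p, hp⟩ := isCentral_iff.1 hj
  let τ : Space ℓ →ₗ[ℂ] Space ℓ := D.ofFactor j ∘ₗ D.toFactor j
  refine ⟨LinearMap.prod (τ.dualMap ∘ₗ LinearMap.fst ℂ _ _)
    (LinearMap.applyₗ (τ p) ∘ₗ LinearMap.fst ℂ _ _), ?_, ?_, ?_⟩
  · intro H hH
    refine Prod.ext (LinearMap.ext fun u => form_ofFactor_toFactor hH u) ?_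
    exact (form_ofFactor_toFactor hH p).trans (hp H hH)
  · intro H hH
    obtain ⟨i, hi⟩ := D.exists_mem_block H
    have hij : i ≠ j := fun h => hH (h ▸ hi)
    exact Prod.ext (LinearMap.ext fun u => form_ofFactor_of_ne hi hij _)
      (form_ofFactor_of_ne hi hij _)
  · refine Prod.ext (LinearMap.ext fun u => ?_) ?_ <;> simp [vecInf]

/-- The central blocks, with a hyperplane chosen in each of them. -/
def blockSystem (D : IrreducibleDecomposition A) (hA : A.IsEssential) :
    BlockSystem A {j : Fin D.r // (D.factor j).IsCentral} where
  block a := D.block a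
  proj a := (exists_isBlockProj a.2).choose
  isBlockProj a := (exists_isBlockProj a.2).choose_spec
  base a := (block_nonempty hA a.1).choose
  base_mem a := (block_nonempty hA a.1).choose_spec
  disjoint _ _ _ ha hb := Subtype.ext (block_disjoint ha hb)

/-- The equations of the hyperplanes of a block do not split into two independent parts, even if
the equation of the hyperplane at infinity is added to one of them. -/
lemma eq_empty_or_eq_empty (hA : A.IsEssential) {P Q : Set A.hyperplanes}
    (hP : ∀ H ∈ P, H ∈ D.block j) (hQ : ∀ H ∈ Q, H ∈ D.block j)
    (hPQ : ∀ H ∈ D.block j, H ∈ P ∨ H ∈ Q)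
    (h : (span ℂ (vec A '' P) ⊔ span ℂ {vecInf ℓ}) ⊓ span ℂ (vec A '' Q) ≤ ⊥) :
    P = ∅ ∨ Q = ∅ := by
  let g : A.hyperplanes → Dual ℂ (Space (D.dim j)) := fun H => form A H ∘ₗ D.ofFactor j
  let G : (Dual ℂ (Space ℓ) × ℂ) →ₗ[ℂ] Dual ℂ (Space (D.dim j)) :=
    (D.ofFactor j).dualMap ∘ₗ LinearMap.fst ℂ _ _
  have hG : ∀ X : Set A.hyperplanes, span ℂ (g '' X) = (span ℂ (vec A '' X)).map G := by
    intro X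
    rw [map_span, Set.image_image]
    rfl
  have hfst : ∀ w ∈ span ℂ (vec A '' {H | H ∈ D.block j}), G w ∘ₗ D.toFactor j = w.1 := by
    intro w hw
    refine span_induction (p := fun w _ => G w ∘ₗ D.toFactor j = w.1) ?_ ?_ ?_ ?_ hw
    · rintro _ ⟨H, hH, rfl⟩
      exact LinearMap.ext fun u => form_ofFactor_toFactor hH u
    · simp
    · intro x y _ _ hx hy
      rw [map_add, LinearMap.add_comp, hx, hy, Prod.fst_add]
    · intro a x _ hx
      rw [map_smul, LinearMap.smul_comp, hx, Prod.smul_fst]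
  -- Equations with equal linear parts differ by a multiple of `vecInf ℓ`; this is why that vector
  -- is included in the independence hypothesis.
  have hinf : span ℂ (g '' P) ⊓ span ℂ (g '' Q) = ⊥ := by
    rw [eq_bot_iff, hG, hG]
    rintro _ ⟨⟨w₁, h₁, rfl⟩, ⟨w₂, h₂, he⟩⟩
    have hmem : w₂ - w₁ ∈ span ℂ (vec A '' {H | H ∈ D.block j}) :=
      sub_mem (span_mono (Set.image_mono hQ) h₂) (span_mono (Set.image_mono hP) h₁)
    have h0 : (w₂ - w₁).1 = 0 := by
      rw [← hfst _ hmem, map_sub, he, sub_self, LinearMap.zero_comp]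
    have h3 : w₂ - w₁ = (w₂ - w₁).2 • vecInf ℓ := by
      refine Prod.ext ?_ ?_
      · rw [h0]; simp [vecInf]
      · simp [vecInf]
    have h4 : w₂ = w₁ + (w₂ - w₁).2 • vecInf ℓ := by rw [← h3]; abel
    have h5 : w₂ = 0 := by
      rw [← mem_bot ℂ]
      refine h ⟨?_, h₂⟩
      rw [h4]
      exact add_mem (mem_sup_left h₁) (mem_sup_right (smul_mem _ _ (mem_span_singleton_self _)))
    rw [← he, h5, map_zero]
    exact zero_mem _
  have hmemco : ∀ (X : Set A.hyperplanes) (u : Space (D.dim j)),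
      u ∈ (span ℂ (g '' X)).dualCoannihilator ↔ ∀ H ∈ X, form A H (D.ofFactor j u) = 0 := by
    intro X u
    rw [mem_dualCoannihilator]
    constructor
    · exact fun hu H hH => hu (g H) (subset_span ⟨H, hH, rfl⟩)
    · intro hu φ hφ
      refine span_induction (p := fun φ _ => φ u = 0) ?_ ?_ ?_ ?_ hφ
      · rintro _ ⟨H, hH, rfl⟩
        exact hu H hH
      · simp
      · intro x y _ _ hx hy
        simp [hx, hy]
      · intro a x _ hx
        simp [hx]
  -- The common kernels of the forms in `P` and in `Q` meet trivially by essentiality and span by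
  -- duality with `hinf`. The hyperplanes of each part are invariant under its own kernel, so
  -- irreducibility applies.
  have hcompl : IsCompl (span ℂ (g '' P)).dualCoannihilator
      (span ℂ (g '' Q)).dualCoannihilator := by
    constructor
    · rw [disjoint_def]
      intro u hu hu'
      refine eq_zero_of_form_ofFactor_eq_zero hA fun H hH => ?_
      rcases hPQ H hH with h | h
      exacts [(hmemco _ _).1 hu H h, (hmemco _ _).1 hu' H h]
    · rw [codisjoint_iff, ← Subspace.dualAnnihilator_inj, dualAnnihilator_sup_eq,
        Subspace.dualCoannihilator_dualAnnihilator_eq,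
        Subspace.dualCoannihilator_dualAnnihilator_eq, hinf, dualAnnihilator_top]
  have hempty : ∀ X : Set A.hyperplanes, (∀ H ∈ X, H ∈ D.block j) →
      (span ℂ (g '' X)).dualCoannihilator = ⊤ → X = ∅ := by
    intro X hX htop
    refine Set.eq_empty_of_forall_notMem fun H hH => form_ne_zero A H (LinearMap.ext fun u => ?_)
    rw [← form_ofFactor_toFactor (hX H hH)]
    exact (hmemco X _).1 (htop ▸ mem_top) H hH
  have htrans : ∀ (X : Set A.hyperplanes) (H : A.hyperplanes)
      (H' : AffineSubspace ℂ (Space (D.dim j))), H ∈ X →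
      (∀ p, form A H p = level A H ↔ D.coord p j ∈ H') → ∀ v,
      ∀ u ∈ (span ℂ (g '' X)).dualCoannihilator, v + u ∈ H' ↔ v ∈ H' := by
    intro X H H' hH hH' v u hu
    have h1 := hH' (D.point j v + D.ofFactor j u)
    rw [coord_add, coord_point, toFactor_ofFactor, map_add, (hmemco X u).1 hu H hH, add_zero,
      hH', coord_point] at h1
    exact h1.symm
  refine ((D.irreducible j).eq_bot_or_eq_bot hcompl ?_).symm.imp (fun hbot => ?_) fun hbot => ?_
  · intro H' hH'
    obtain ⟨H, hH, hHH'⟩ := exists_of_mem_factor hH'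
    rcases hPQ H hH with h | h
    exacts [Or.inl (htrans P H H' h hHH'), Or.inr (htrans Q H H' h hHH')]
  · rw [hbot] at hcompl
    exact hempty P hP (eq_top_of_isCompl_bot hcompl)
  · rw [hbot] at hcompl
    exact hempty Q hQ (eq_top_of_bot_isCompl hcompl)

/-- The equations of all the hyperplanes are connected modulo the gluing. -/
lemma not_inf_le_gluing (hA : A.IsEssential) {Q : Set A.hyperplanes} (hQ : Q.Nonempty) :
    ¬ sp (vec A) (D.blockSystem hA).gluing Q ⊓
        sp (vec A) ((D.blockSystem hA).gluing ⊔ span ℂ {vecInf ℓ}) Qᶜ ≤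
      (D.blockSystem hA).gluing := by
  classical
  intro hle
  have hY : vecInf ℓ ∈ sp (vec A) ((D.blockSystem hA).gluing ⊔ span ℂ {vecInf ℓ}) Qᶜ :=
    le_sp _ _ _ (mem_sup_right (mem_span_singleton_self _))
  have hX : vecInf ℓ ∉ sp (vec A) (D.blockSystem hA).gluing Q := fun h =>
    BlockSystem.vecInf_notMem_gluing (hle ⟨h, hY⟩)
  have hbase : ∀ a, (D.blockSystem hA).base a ∉ Q := fun a ha =>
    hX (sp_mono _ le_rfl (Set.singleton_subset_iff.2 ha) (BlockSystem.vecInf_mem_sp_base a))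
  obtain ⟨H, hH⟩ := hQ
  obtain ⟨b, hb⟩ := D.exists_mem_block H
  have hproj : ∀ a : {j : Fin D.r // (D.factor j).IsCentral}, ∀ w ∈ span ℂ (vec A ''
      {H | H ∈ Q ∧ H ∈ D.block b}), (D.blockSystem hA).proj a w = if a.1 = b then w else 0 := by
    intro a w hw
    refine span_induction
      (p := fun w _ => (D.blockSystem hA).proj a w = if a.1 = b then w else 0) ?_ ?_ ?_ ?_ hw
    · rintro _ ⟨H, hH, rfl⟩
      split_ifs with hab
      · exact ((D.blockSystem hA).isBlockProj a).of_mem H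
          (show H ∈ D.block a from hab ▸ hH.2)
      · exact ((D.blockSystem hA).isBlockProj a).of_notMem H
          fun h => hab (block_disjoint h hH.2)
    · simp
    · intro x y _ _ hx hy
      rw [map_add, hx, hy]
      split_ifs <;> simp
    · intro c x _ hx
      rw [map_smul, hx]
      split_ifs <;> simp
  -- An element of this intersection lies in the gluing by `hle`. The projections to the other
  -- blocks kill it, leaving at most one coefficient; the projection to block `b` fixes it, which
  -- kills the last coefficient since `vecInf ℓ ≠ 0`.
  have hinf : (span ℂ (vec A '' {H | H ∈ Qᶜ ∧ H ∈ D.block b}) ⊔ span ℂ {vecInf ℓ}) ⊓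
      span ℂ (vec A '' {H | H ∈ Q ∧ H ∈ D.block b}) ≤ ⊥ := by
    rintro y ⟨h₁, h₂⟩
    have hyU : y ∈ (D.blockSystem hA).gluing := by
      refine hle ⟨mem_sup_right (span_mono (Set.image_mono fun H h => h.1) h₂), ?_⟩
      refine (sup_le ?_ ?_ : _ ≤ sp (vec A) _ Qᶜ) h₁
      · exact (span_mono (Set.image_mono fun H h => h.1)).trans le_sup_right
      · exact le_sup_right.trans (le_sp _ _ _)
    obtain ⟨c, hc, hπ⟩ := BlockSystem.exists_of_mem_gluing hyU
    have hc' : ∀ a, a.1 ≠ b → c a = 0 := by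
      intro a ha
      have := hπ a
      rw [hproj a y h₂, if_neg ha] at this
      exact (smul_eq_zero.1 this.symm).resolve_right (vec_ne_zero A _)
    rw [mem_bot, hc]
    refine Finset.sum_eq_zero fun a _ => ?_
    by_cases hab : a.1 = b
    · have h3 := hπ a
      rw [hproj a y h₂, if_pos hab, hc, Finset.sum_eq_single a, smul_sub, sub_eq_self,
        smul_eq_zero] at h3
      · rw [h3.resolve_right vecInf_ne_zero, zero_smul]
      · intro a' _ ha'
        rw [hc' a' fun h => ha' (Subtype.ext (h.trans hab.symm)), zero_smul]
      · simp
    · rw [hc' a hab, zero_smul]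
  have hPQ : ∀ H ∈ D.block b, H ∈ {H | H ∈ Qᶜ ∧ H ∈ D.block b} ∨
      H ∈ {H | H ∈ Q ∧ H ∈ D.block b} := by
    intro H h
    by_cases h' : H ∈ Q
    exacts [Or.inr ⟨h', h⟩, Or.inl ⟨h', h⟩]
  -- As `Q` meets block `b`, it must contain the whole block. Then `Q` contains a chosen hyperplane
  -- if the block is central, or spans `vecInf ℓ` if it is not; both are excluded.
  rcases eq_empty_or_eq_empty hA (fun _ h => h.2) (fun _ h => h.2) hPQ hinf with hemp | hemp
  · have hsub : ∀ H ∈ D.block b, H ∈ Q := by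
      intro H hH
      by_contra h
      exact Set.notMem_empty H (hemp ▸ ⟨h, hH⟩ : H ∈ (∅ : Set A.hyperplanes))
    by_cases hc : (D.factor b).IsCentral
    · exact hbase ⟨b, hc⟩ (hsub _ ((D.blockSystem hA).base_mem ⟨b, hc⟩))
    · refine hX (mem_sup_right ?_)
      by_contra h
      obtain ⟨p, hp⟩ := vecInf_notMem_span_iff.1 h
      exact hc (isCentral_iff.2 ⟨p, fun H hH => hp H (hsub H hH)⟩)
  · exact Set.notMem_empty H (hemp ▸ ⟨hH, hb⟩ : H ∈ (∅ : Set A.hyperplanes))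

end IrreducibleDecomposition

end Irreducible

end OSArr

end

noncomputable section

namespace OSArr

/-! ### Existence of irreducible decompositions -/

section Existence

/-- A reducible arrangement is a product in smaller positive dimensions, to which induction applies;
in dimension zero there is no nonzero form and hence no hyperplane. General finite index types make
combining two decompositions a disjoint sum. -/
lemma Arrangement.exists_irreducible_factors (ℓ : ℕ) : ∀ A : Arrangement ℓ,
    ∃ (κ : Type) (_ : Fintype κ) (dim : κ → ℕ) (factor : ∀ j, Arrangement (dim j))
      (coord : Space ℓ ≃ᵃ[ℂ] ∀ j, Space (dim j)), (∀ j, (factor j).IsIrreducible) ∧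
      ∀ H : AffineSubspace ℂ (Space ℓ), H ∈ A.hyperplanes ↔
        ∃ j, ∃ H' ∈ (factor j).hyperplanes, ∀ v, v ∈ H ↔ coord v j ∈ H' := by
  induction ℓ using Nat.strong_induction_on with
  | _ ℓ ih =>
    intro A
    rcases Nat.eq_zero_or_pos ℓ with rfl | hℓ
    · refine ⟨Empty, inferInstance, fun _ => 0, fun j => j.elim,
        (LinearEquiv.ofSubsingleton _ _).toAffineEquiv, fun j => j.elim, fun H => ?_⟩
      constructor
      · intro hH
        exact absurd (Subsingleton.elim _ _) (form_ne_zero A ⟨H, hH⟩)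
      · rintro ⟨j, -⟩
        exact j.elim
    by_cases hirr : A.IsIrreducible
    · refine ⟨Unit, inferInstance, fun _ => ℓ, fun _ => A,
        (LinearEquiv.funUnique Unit ℂ (Space ℓ)).symm.toAffineEquiv, fun _ => hirr, fun H => ?_⟩
      constructor
      · exact fun hH => ⟨(), H, hH, fun v => Iff.rfl⟩
      · rintro ⟨_, H', hH', h⟩
        rwa [show H = H' from SetLike.ext h]
    · obtain ⟨k, m, B, C, ⟨φ, hφ⟩, hk, hm⟩ : ∃ k m, ∃ (B : Arrangement k) (C : Arrangement m),
          A.IsProduct B C ∧ k ≠ 0 ∧ m ≠ 0 := by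
        simp only [IsIrreducible, hℓ, true_and] at hirr
        push Not at hirr
        exact hirr
      have hkm : ℓ = k + m := by
        simpa using φ.linear.finrank_eq
      obtain ⟨κB, _, dB, fB, cB, hB, hB'⟩ := ih k (by omega) B
      obtain ⟨κC, _, dC, fC, cC, hC, hC'⟩ := ih m (by omega) C
      refine ⟨κB ⊕ κC, inferInstance, Sum.elim dB dC, Sum.rec fB fC,
        φ.trans ((cB.prodCongr cC).trans (LinearEquiv.sumPiEquivProdPi ℂ κB κC
          (fun j => Space (Sum.elim dB dC j))).symm.toAffineEquiv), ?_, fun H => ?_⟩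
      · rintro (j | j)
        exacts [hB j, hC j]
      rw [hφ]
      constructor
      · rintro (⟨H', hH', rfl⟩ | ⟨H', hH', rfl⟩)
        · obtain ⟨j, H'', hH'', h⟩ := (hB' H').1 hH'
          exact ⟨Sum.inl j, H'', hH'', fun v => h _⟩
        · obtain ⟨j, H'', hH'', h⟩ := (hC' H').1 hH'
          exact ⟨Sum.inr j, H'', hH'', fun v => h _⟩
      · rintro ⟨j | j, H'', hH'', h⟩
        · exact Or.inl ⟨H''.comap ((AffineMap.proj (k := ℂ) j).comp cB.toAffineMap),
            (hB' _).2 ⟨j, H'', hH'', fun v => Iff.rfl⟩, SetLike.ext h⟩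
        · exact Or.inr ⟨H''.comap ((AffineMap.proj (k := ℂ) j).comp cC.toAffineMap),
            (hC' _).2 ⟨j, H'', hH'', fun v => Iff.rfl⟩, SetLike.ext h⟩

theorem IrreducibleDecomposition.nonempty {ℓ : ℕ} (A : Arrangement ℓ) :
    Nonempty (IrreducibleDecomposition A) := by
  obtain ⟨κ, _, dim, factor, coord, hirr, hmem⟩ := A.exists_irreducible_factors
  let f := Fintype.equivFin κ
  refine ⟨⟨Fintype.card κ, fun i => dim (f.symm i), fun i => factor (f.symm i),
    fun i => hirr _, coord.trans
      (LinearEquiv.piCongrLeft' ℂ (fun j => Space (dim j)) f).toAffineEquiv, fun H => ?_⟩⟩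
  rw [hmem, ← f.symm.exists_congr_right]
  refine exists_congr fun i => exists_congr fun H' => and_congr_right fun _ => ?_
  exact ⟨fun h => SetLike.ext h, fun h v => SetLike.ext_iff.1 h v⟩

end Existence

/-! ### Singular varieties, duality and codimension -/

section Singular

open Module

variable {K : Type*} [Field K]

/-- Kernel and range of the transpose are the annihilators of the range and kernel, and a subspace
over a field is determined by its annihilator, in any dimension. -/
lemma ker_dualMap_eq_range_iff {M : Type*} [AddCommGroup M] [Module K M] (T : M →ₗ[K] M) :
    LinearMap.ker T.dualMap = LinearMap.range T.dualMap ↔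
      LinearMap.ker T = LinearMap.range T := by
  rw [LinearMap.ker_dualMap_eq_dualAnnihilator_range,
    LinearMap.range_dualMap_eq_dualAnnihilator_ker, Subspace.dualAnnihilator_inj, eq_comm]

/-- The anti-automorphism in the dual action fixes degree one, so `x` acts on the dual by the
transpose of its action. -/
lemma singularVariety_dualModule (U : Type*) [AddCommGroup U] [Module K U]
    (M : Type*) [AddCommGroup M] [Module K M] [Module (ExteriorAlgebra K U) M]
    [IsScalarTower K (ExteriorAlgebra K U) M] :
    singularVariety K U (DualModule K U M) = singularVariety K U M := by
  ext x
  let T : M →ₗ[K] M :=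
    Module.toModuleEnd K (S := ExteriorAlgebra K U) M (ExteriorAlgebra.ι K x)
  have hT : ∀ f : DualModule K U M, ExteriorAlgebra.ι K x • f = T.dualMap f := by
    intro f
    change (show Module.Dual K M from f) ∘ₗ Module.toModuleEnd K (S := ExteriorAlgebra K U) M
      (CliffordAlgebra.reverse (ExteriorAlgebra.ι K x)) = _
    rw [show CliffordAlgebra.reverse (ExteriorAlgebra.ι K x) = ExteriorAlgebra.ι K x from
      CliffordAlgebra.reverse_ι x]
    rfl
  refine not_congr ?_
  have h := ker_dualMap_eq_range_iff T
  rw [← SetLike.coe_set_eq (p := LinearMap.ker T), ← SetLike.coe_set_eq] at h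
  refine Iff.trans ?_ h
  simp only [hT]
  rfl

variable {ℓ : ℕ} {A : Arrangement ℓ}

lemma mem_singularVariety_iff {x : V K A} : x ∈ singularVariety K (V K A) (OSAlgebra K A) ↔
    ¬ ExactOn (TwoSidedIdeal.span (osGenerators K A)) x := by
  refine not_congr ?_
  have h0 : ∀ a : E K A, (Ideal.Quotient.mk (osIdeal K A) a : OSAlgebra K A) = 0 ↔
      a ∈ TwoSidedIdeal.span (osGenerators K A) := fun a =>
    Ideal.Quotient.eq_zero_iff_mem.trans Iff.rfl
  have hs : ∀ a : E K A, ExteriorAlgebra.ι K x • (Ideal.Quotient.mk (osIdeal K A) a) =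
      Ideal.Quotient.mk (osIdeal K A) (ExteriorAlgebra.ι K x * a) := fun a => rfl
  constructor
  · intro h a ha
    have hmem : Ideal.Quotient.mk (osIdeal K A) a ∈
        {m : OSAlgebra K A | ExteriorAlgebra.ι K x • m = 0} := by
      rw [Set.mem_ofPred_eq, hs, h0]
      exact ha
    rw [h] at hmem
    obtain ⟨m, hm⟩ := hmem
    obtain ⟨b, rfl⟩ := Ideal.Quotient.mk_surjective m
    refine ⟨b, (h0 _).1 ?_⟩
    rw [map_sub, ← hs, sub_eq_zero]
    exact hm.symm
  · intro h
    ext m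
    obtain ⟨a, rfl⟩ := Ideal.Quotient.mk_surjective m
    rw [Set.mem_ofPred_eq, hs, h0]
    constructor
    · intro ha
      obtain ⟨b, hb⟩ := h a ha
      refine ⟨Ideal.Quotient.mk _ b, ?_⟩
      have := (h0 _).2 hb
      rw [map_sub, sub_eq_zero] at this
      exact this.symm
    · rintro ⟨m, hm⟩
      obtain ⟨b, rfl⟩ := Ideal.Quotient.mk_surjective m
      rw [← h0, ← hs, ← hm]
      change ExteriorAlgebra.ι K x • ExteriorAlgebra.ι K x • Ideal.Quotient.mk (osIdeal K A) b = 0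
      rw [smul_smul, ExteriorAlgebra.ι_sq_zero, zero_smul]

lemma IrreducibleDecomposition.not_exactOn_iff (D : IrreducibleDecomposition A)
    (hA : A.IsEssential) {x : V K A} :
    ¬ ExactOn (TwoSidedIdeal.span (osGenerators K A)) x ↔
      ∀ j : Fin D.r, (D.factor j).IsCentral → ∑ H ∈ D.block j, x H = 0 := by
  classical
  constructor
  · intro h j hj
    by_contra hx
    obtain ⟨π, hπ⟩ := exists_isBlockProj hj
    refine h (exactOn_of_ne_zero (θ := blockForm K (D.block j)) (fun y hy => ?_) ?_)
    · rw [← osGeneratorsAdd_empty] at hy ⊢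
      exact hπ.contr_mem (by simp) hy
    · rwa [blockForm_apply]
  · intro h
    exact (D.blockSystem hA).not_exactOn (fun Q hQ => not_inf_le_gluing hA hQ)
      fun a => h a.1 a.2

namespace BlockSystem

variable {κ : Type*} (S : BlockSystem A κ)

/-- The sums of the coordinates over the blocks. -/
def sums (K : Type*) [Field K] : (A.hyperplanes → K) →ₗ[K] (κ → K) :=
  LinearMap.pi fun a => blockForm K (S.block a)

/-- The chosen generators have disjoint blocks, so the sums map their span onto everything; this
makes the codimension the number of blocks. -/
lemma sums_surjective [Fintype κ] : Function.Surjective (S.sums K) := by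
  classical
  intro c
  refine ⟨∑ b, c b • Pi.single (S.base b) 1, funext fun a => ?_⟩
  rw [sums, LinearMap.pi_apply, map_sum, Finset.sum_eq_single a]
  · have := blockForm_single (K := K) (S.block a) (S.base a)
    rw [if_pos (S.base_mem a)] at this
    rw [map_smul, smul_eq_mul]
    convert mul_one _
    convert this
  · intro b _ hb
    have := blockForm_single (K := K) (S.block a) (S.base b)
    rw [if_neg fun h => hb (S.disjoint _ _ _ (S.base_mem b) h)] at this
    rw [map_smul, smul_eq_mul]
    convert mul_zero _
    convert this
  · simp

lemma finrank_quotient_ker_sums [Fintype κ] :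
    finrank K ((A.hyperplanes → K) ⧸ LinearMap.ker (S.sums K)) = Nat.card κ := by
  rw [(LinearMap.quotKerEquivOfSurjective _ S.sums_surjective).finrank_eq,
    finrank_fintype_fun_eq_card, Nat.card_eq_fintype_card]

end BlockSystem

end Singular

end OSArr

end

theorem corollary2p3 (K : Type*) [Field K] {ℓ : ℕ} (A : OSArr.Arrangement ℓ)
    (hA : A.IsEssential) :
    Nonempty (OSArr.IrreducibleDecomposition A) ∧
    ∀ D : OSArr.IrreducibleDecomposition A,
      ∃ L : Submodule K (OSArr.V K A),
        (∀ x : OSArr.V K A, x ∈ L ↔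
          ∀ j : Fin D.r, (D.factor j).IsCentral → ∑ H ∈ D.block j, x H = 0) ∧
        OSArr.singularVariety K (OSArr.V K A) (OSArr.OSAlgebra K A) = (L : Set (OSArr.V K A)) ∧
        OSArr.singularVariety K (OSArr.V K A) (OSArr.HomologyModule K A) =
          (L : Set (OSArr.V K A)) ∧
        Module.finrank K (OSArr.V K A ⧸ L) =
          Nat.card {j : Fin D.r // (D.factor j).IsCentral} := by
  classical
  refine ⟨OSArr.IrreducibleDecomposition.nonempty A, fun D => ?_⟩
  have hmem : ∀ x, x ∈ LinearMap.ker ((D.blockSystem hA).sums K) ↔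
      ∀ j : Fin D.r, (D.factor j).IsCentral → ∑ H ∈ D.block j, x H = 0 := by
    intro x
    rw [LinearMap.mem_ker, funext_iff, Subtype.forall]
    refine forall_congr' fun j => forall_congr' fun hj => ?_
    rw [OSArr.BlockSystem.sums, LinearMap.pi_apply, OSArr.blockForm_apply]
    rfl
  have hsing : OSArr.singularVariety K (OSArr.V K A) (OSArr.OSAlgebra K A) =
      (LinearMap.ker ((D.blockSystem hA).sums K) : Set (OSArr.V K A)) := by
    ext x
    rw [OSArr.mem_singularVariety_iff, D.not_exactOn_iff hA, SetLike.mem_coe, hmem]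
  exact ⟨_, hmem, hsing, (OSArr.singularVariety_dualModule _ _).trans hsing,
    (D.blockSystem hA).finrank_quotient_ker_sums⟩
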